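/- Let $x\in\mathbb C\setminus\{0\}$ with $|\arg x|<\pi$, $t>0$, $m\in\mathbb R$ and $k\in\mathbb C$ with $\operatorname{Re}k<\tfrac12$. Let $W_{k,m}$ be the Whittaker function on $|\arg z|<\pi$. If $\operatorname{Re}(\tfrac12+m-k)>0$, it is given by $$W_{k,m}(z)=\frac{e^{-z/2}z^{k}}{\Gamma(\frac12+m-k)}\int_0^\infty e^{-s}s^{m-k-\frac12}\Bigl(1+\frac sz\Bigr)^{m+k-\frac12}\,ds ,$$ and otherwise by $W_{k,m}=W_{k,-m}$. (Since $\operatorname{Re}k<\frac12$, at least one of $\operatorname{Re}(\frac12\pm m-k)$ is positive.) Then $$(t|x|)^{-1}e^{t\operatorname{Re}x}\,|W_{k,m}(tx)|^2=\frac{|x|^{2m}}{\Gamma(1-2\operatorname{Re}k)}\int_0^\infty e^{-tu}\,\bigl|(x+u)^{k-\frac12-m}\bigr|^2u^{-2\operatorname{Re}k}\;{}_2F_1\!\left(\tfrac12+m-k,\tfrac12+m-\bar k;\,1-2\operatorname{Re}k;\,\frac{u(2\operatorname{Re}x+u)}{|x+u|^2}\right)du ,$$ where the integral converges absolutely. All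 powers have their principal values. The argument of ${}_2F_1$ is real and less than $1$ for $u>0$, and ${}_2F_1(a,b;c;v)$ denotes, for real $v<1$, the analytic continuation along $(-\infty,1)$ of the sum of the hypergeometric series on $(-1,1)$. -/

import Mathlib

/-- Whittaker's integral
`e^{-z/2} z^k / Γ(1/2 + m - k) * ∫₀^∞ e^{-s} s^{m-k-1/2} (1 + s/z)^{m+k-1/2} ds`,
with principal values of all powers.  For `Re (1/2 + m - k) > 0` and `|arg z| < π` it converges
absolutely and is the classical definition of the Whittaker function `W_{k,m}(z)`. -/
noncomputable def whittakerIntegral (k m z : ℂ) : ℂ :=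
  Complex.exp (-z / 2) * z ^ k / Complex.Gamma (1 / 2 + m - k) *
    ∫ s in Set.Ioi (0 : ℝ),
      Complex.exp (-(s : ℂ)) * (s : ℂ) ^ (m - k - 1 / 2) * (1 + (s : ℂ) / z) ^ (m + k - 1 / 2)

/-- The (principal branch of the) Whittaker function `W_{k,m}(z)`, for `|arg z| < π`, `Re k < 1/2`
and every complex `m`: it is Whittaker's integral when `Re (1/2 + m - k) > 0`, and otherwise it is
determined by `W_{k,m} = W_{k,-m}`.  Since `Re (1/2 + m - k) + Re (1/2 - m - k) = 1 - 2 Re k > 0`,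
at least one of the two integrals converges for all these parameters. -/
noncomputable def whittakerW (k m z : ℂ) : ℂ :=
  if 0 < (1 / 2 + m - k).re then whittakerIntegral k m z else whittakerIntegral k (-m) z

/-- `F` is the analytic continuation along the real interval `(-∞, 1)` of the principal value of
Gauss's hypergeometric function, i.e. of the sum of the hypergeometric series on `(-1, 1)`. -/
structure IsHypergeometricContinuation (a b c : ℂ) (F : ℝ → ℂ) : Prop where
  analytic : AnalyticOnNhd ℝ F (Set.Iio 1)
  eq_series : ∀ v : ℝ, |v| < 1 → F v = ordinaryHypergeometric a b c (v : ℂ)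

/-- The continuation is unique on `(-∞, 1)`. -/
theorem IsHypergeometricContinuation.eqOn {a b c : ℂ} {F G : ℝ → ℂ}
    (hF : IsHypergeometricContinuation a b c F) (hG : IsHypergeometricContinuation a b c G) :
    Set.EqOn F G (Set.Iio 1) := by
  refine hF.analytic.eqOn_of_preconnected_of_eventuallyEq hG.analytic isPreconnected_Iio
    (z₀ := 0) (by simp) ?_
  filter_upwards [Metric.ball_mem_nhds (0 : ℝ) one_pos] with v hv
  have hv' : |v| < 1 := by simpa using hv
  rw [hF.eq_series v hv', hG.eq_series v hv']

open Classical in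
/-- The principal branch of Gauss's hypergeometric function `₂F₁(a, b; c; v)` at real `v < 1`
(with `c` not in `{0, -1, -2, …}`): the analytic continuation along `(-∞, 1)` of the sum of the
hypergeometric series. -/
noncomputable def hypergeometricF (a b c : ℂ) (v : ℝ) : ℂ :=
  if h : ∃ F : ℝ → ℂ, IsHypergeometricContinuation a b c F then h.choose v else 0

/-- The density (without the constant factor in front of the integral): for `u > 0`,
`|(x+u)^{k-1/2-m}|² u^{-2 Re k} ₂F₁(1/2+m-k, 1/2+m-k̄; 1-2 Re k; u(2 Re x+u)/|x+u|²)`. -/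
noncomputable def whittakerDensity (k : ℂ) (m : ℝ) (x : ℂ) (u : ℝ) : ℂ :=
  ((‖(x + (u : ℂ)) ^ (k - 1 / 2 - (m : ℂ))‖ ^ 2 * u ^ (-2 * k.re) : ℝ) : ℂ) *
    hypergeometricF (1 / 2 + (m : ℂ) - k) (1 / 2 + (m : ℂ) - (starRingEnd ℂ) k)
      ((1 - 2 * k.re : ℝ) : ℂ) (u * (2 * x.re + u) / ‖x + (u : ℂ)‖ ^ 2)

/-! Up to elementary factors, W_{k,m}(tx) is a Laplace transform in t. For Re b, Re c > 0 and y off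
the negative axis, t^c / Γ(c) * ∫ e^{-tu} u^{c-1} ₂F₁(a, b; c; -uy) du does not depend on c, and at
c = b the function ₂F₁(a, b; b; -uy) is the binomial (1 + uy)^{-a} of Whittaker's integral. Choosing
c = 1/2 - k gives a kernel ₂F₁(1/2+m-k, 1/2-m-k; 1/2-k; -u/x) that is symmetric under m ↦ -m, so
both branches of `whittakerW` lead to the same formula (`exists_whittakerW_eq`).

Then |W|² is a Laplace transform times its conjugate, hence the Laplace transform of a convolution
on (0, u). It remains to evaluate the convolution of u^{p-1} ₂F₁(a, p+q-b; p; -u/x) with its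
conjugate, where a = 1/2+m-k, b = conj a, p = 1/2-k, q = conj p. Expanded in X = u/x and Y = conj X
it is an Appell series F₃ whose parameters are exactly those for which F₃ collapses to (1+X)^{-a}
(1+Y)^{-b} ₂F₁(a, b; p+q; 1 - 1/((1+X)(1+Y))) (`hasSum_appell`). The last argument is 1 -
|x|²/|x+u|² = u(2 Re x + u)/|x+u|².

The collapse is a Taylor expansion in X, valid for small u. Both sides are real analytic in u > 0,
so the identity theorem extends it to all u (`betaIntegral_mul_norm_cpow_mul_hypergeometricF`). This
requires ₂F₁ on the plane cut along [1, ∞), obtained from Euler's integral and contiguous relations.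
-/

open Filter Topology Set MeasureTheory
open scoped Interval ComplexConjugate

/-! ### Gauss's series inside the unit disc: derivative and contiguous relations. -/

section HypergeometricSeries

theorem ascPochhammer_eval_ne_zero_of_re_pos {c : ℂ} (hc : 0 < c.re) (n : ℕ) :
    (ascPochhammer ℂ n).eval c ≠ 0 := by
  rw [Ne, ascPochhammer_eval_eq_zero_iff]
  rintro ⟨k, -, hk⟩
  have : (k : ℂ).re = -c.re := by rw [hk]; simp
  simp only [Complex.natCast_re] at this
  have := Nat.cast_nonneg (α := ℝ) k
  linarith

theorem ascPochhammer_succ_eval_left (n : ℕ) (a : ℂ) :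
    (ascPochhammer ℂ (n + 1)).eval a = a * (ascPochhammer ℂ n).eval (a + 1) := by
  rw [ascPochhammer_succ_left, Polynomial.eval_mul, Polynomial.eval_X, Polynomial.eval_comp]
  simp

theorem Complex.ne_zero_of_re_pos' {c : ℂ} (hc : 0 < c.re) : c ≠ 0 := by
  rintro rfl
  simp at hc

/-- The series `₂F₁(a, b; c; ·)` has radius of convergence at least one. -/
theorem one_le_radius_ordinaryHypergeometricSeries (a b : ℂ) {c : ℂ} (hc : 0 < c.re) :
    1 ≤ (ordinaryHypergeometricSeries ℂ a b c).radius := by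
  by_cases ha : ∃ k : ℕ, (k : ℂ) = -a
  · obtain ⟨k, hk⟩ := ha
    obtain rfl : a = -(k : ℂ) := by rw [hk, neg_neg]
    rw [ordinaryHypergeometric_radius_top_of_neg_nat₁]
    exact le_top
  by_cases hb : ∃ k : ℕ, (k : ℂ) = -b
  · obtain ⟨k, hk⟩ := hb
    obtain rfl : b = -(k : ℂ) := by rw [hk, neg_neg]
    rw [ordinaryHypergeometric_radius_top_of_neg_nat₂]
    exact le_top
  push Not at ha hb
  refine (ordinaryHypergeometricSeries_radius_eq_one ℂ a b c fun k ↦ ⟨ha k, hb k, ?_⟩).ge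
  intro hk
  have := congrArg Complex.re hk
  simp only [Complex.natCast_re, Complex.neg_re] at this
  have := Nat.cast_nonneg (α := ℝ) k
  linarith

theorem summable_norm_ordinaryHypergeometric (a b : ℂ) {c : ℂ} (hc : 0 < c.re) {z : ℂ}
    (hz : ‖z‖ < 1) :
    Summable fun n ↦ ‖ordinaryHypergeometricCoefficient a b c n * z ^ n‖ := by
  have h := (ordinaryHypergeometricSeries ℂ a b c).summable_norm_apply (x := z) (by
    rw [Metric.mem_eball, edist_zero_right]
    refine lt_of_lt_of_le ?_ (one_le_radius_ordinaryHypergeometricSeries a b hc)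
    rw [enorm_eq_nnnorm]
    exact_mod_cast hz)
  simpa [ordinaryHypergeometricSeries, FormalMultilinearSeries.ofScalars_apply_eq, mul_comm,
    mul_left_comm] using h

theorem hasSum_ordinaryHypergeometric (a b : ℂ) {c : ℂ} (hc : 0 < c.re) {z : ℂ} (hz : ‖z‖ < 1) :
    HasSum (fun n ↦ ordinaryHypergeometricCoefficient a b c n * z ^ n)
      (ordinaryHypergeometric a b c z) := by
  rw [ordinaryHypergeometric_eq_tsum]
  exact (summable_norm_ordinaryHypergeometric a b hc hz).of_norm.hasSum

theorem hasSum_succ_ordinaryHypergeometric (a b : ℂ) {c : ℂ} (hc : 0 < c.re) {z : ℂ}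
    (hz : ‖z‖ < 1) :
    HasSum (fun n ↦ ordinaryHypergeometricCoefficient a b c (n + 1) * z ^ (n + 1))
      (ordinaryHypergeometric a b c z - 1) := by
  have h := (hasSum_nat_add_iff' 1).mpr (hasSum_ordinaryHypergeometric a b hc hz)
  have h0 : ordinaryHypergeometricCoefficient a b c 0 = 1 := by
    simp [ordinaryHypergeometricCoefficient]
  rwa [Finset.sum_range_one, h0, pow_zero, mul_one] at h

theorem ordinaryHypergeometricCoefficient_succ (a b : ℂ) {c : ℂ} (hc : 0 < c.re) (n : ℕ) :
    ordinaryHypergeometricCoefficient a b c (n + 1) * (n + 1) =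
      a * b / c * ordinaryHypergeometricCoefficient (a + 1) (b + 1) (c + 1) n := by
  have h0 := Complex.ne_zero_of_re_pos' hc
  have h1 := ascPochhammer_eval_ne_zero_of_re_pos (c := c + 1) (by simp; linarith) n
  have h2 : (n : ℂ) + 1 ≠ 0 := by exact_mod_cast n.succ_ne_zero
  have h3 : (n.factorial : ℂ) ≠ 0 := by exact_mod_cast n.factorial_ne_zero
  simp only [ordinaryHypergeometricCoefficient, ascPochhammer_succ_eval_left, Nat.factorial_succ]
  push_cast
  field_simp

theorem ordinaryHypergeometric_comm (a b c z : ℂ) :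
    ordinaryHypergeometric a b c z = ordinaryHypergeometric b a c z := by
  rw [ordinaryHypergeometric, ordinaryHypergeometricSeries_symm]; rfl

/-- Termwise differentiation, dominated on a disc of radius r with ‖z‖ < r < 1 by the series at r;
the index shift is `ordinaryHypergeometricCoefficient_succ`. -/
theorem hasDerivAt_ordinaryHypergeometric (a b : ℂ) {c : ℂ} (hc : 0 < c.re) {z : ℂ}
    (hz : ‖z‖ < 1) :
    HasDerivAt (ordinaryHypergeometric a b c)
      (a * b / c * ordinaryHypergeometric (a + 1) (b + 1) (c + 1) z) z := by
  obtain ⟨r, hzr, hr⟩ := exists_between hz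
  have hr0 : 0 ≤ r := (norm_nonneg z).trans hzr.le
  have hc1 : 0 < (c + 1).re := by simp; linarith
  set g : ℕ → ℂ → ℂ := fun n w ↦ ordinaryHypergeometricCoefficient a b c n * w ^ n
  set g' : ℕ → ℂ → ℂ := fun n w ↦ ordinaryHypergeometricCoefficient a b c n * (n * w ^ (n - 1))
  have hs : Summable fun n ↦ ‖g' n r‖ := by
    rw [← summable_nat_add_iff 1]
    have := (summable_norm_ordinaryHypergeometric (a + 1) (b + 1) hc1 (z := (r : ℂ))
      (by simpa [abs_of_nonneg hr0] using hr)).mul_left ‖a * b / c‖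
    refine this.congr fun n ↦ ?_
    rw [← norm_mul, ← mul_assoc, ← ordinaryHypergeometricCoefficient_succ a b hc]
    simp only [g']
    push_cast
    rw [mul_assoc]
  have h := hasDerivAt_tsum_of_isPreconnected (g := g) (g' := g') (t := Metric.ball (0 : ℂ) r)
    (y₀ := 0) (y := z) hs Metric.isOpen_ball
    (convex_ball (0 : ℂ) r).isPreconnected
    (fun n y _ ↦ (hasDerivAt_pow n y).const_mul _)
    (fun n y hy ↦ by
      simp only [g', norm_mul, norm_pow, Complex.norm_real, Real.norm_eq_abs, abs_of_nonneg hr0]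
      have : ‖y‖ ≤ r := by simpa using (mem_ball_zero_iff.mp hy).le
      gcongr)
    (by simpa using (norm_nonneg z).trans_lt hzr)
    (hasSum_ordinaryHypergeometric a b hc (by simp)).summable
    (by simpa using hzr)
  have h' : HasDerivAt (ordinaryHypergeometric a b c) (∑' n, g' n z) z := by
    rw [ordinaryHypergeometric_eq_tsum]
    exact h
  refine h'.congr_deriv ?_
  rw [Summable.tsum_eq_zero_add (by
    refine Summable.of_norm_bounded (g := fun n ↦ ‖g' n r‖) hs fun n ↦ ?_
    simp only [g', norm_mul, norm_pow, Complex.norm_real, Real.norm_eq_abs, abs_of_nonneg hr0]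
    gcongr)]
  rw [← (hasSum_ordinaryHypergeometric _ _ hc1 hz).tsum_eq, ← tsum_mul_left]
  simp only [g', Nat.cast_zero, zero_mul, mul_zero, zero_add]
  refine tsum_congr fun n ↦ ?_
  rw [← mul_assoc (a * b / c), ← ordinaryHypergeometricCoefficient_succ a b hc]
  push_cast
  ring

theorem differentiableOn_ordinaryHypergeometric (a b : ℂ) {c : ℂ} (hc : 0 < c.re) :
    DifferentiableOn ℂ (ordinaryHypergeometric a b c) (Metric.ball (0 : ℂ) 1) := fun z hz ↦
  (hasDerivAt_ordinaryHypergeometric a b hc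
    (by simpa using hz)).differentiableAt.differentiableWithinAt

/-- Contiguous relation lowering the third parameter. -/
theorem ordinaryHypergeometric_eq_add_one_right (a b : ℂ) {c : ℂ} (hc : 0 < c.re) {z : ℂ}
    (hz : ‖z‖ < 1) :
    ordinaryHypergeometric a b c z = ordinaryHypergeometric a b (c + 1) z +
      z * (a * b / (c * (c + 1))) * ordinaryHypergeometric (a + 1) (b + 1) (c + 2) z := by
  have hc1 : 0 < (c + 1).re := by simp; linarith
  have hc2 : 0 < (c + 2).re := by simp; linarith
  have h := (hasSum_succ_ordinaryHypergeometric a b hc1 hz).add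
    ((hasSum_ordinaryHypergeometric (a + 1) (b + 1) hc2 hz).mul_left
      (z * (a * b / (c * (c + 1)))))
  suffices ordinaryHypergeometric a b c z - 1 = ordinaryHypergeometric a b (c + 1) z - 1 +
      z * (a * b / (c * (c + 1))) * ordinaryHypergeometric (a + 1) (b + 1) (c + 2) z by
    linear_combination this
  refine (hasSum_succ_ordinaryHypergeometric a b hc hz).unique (h.congr_fun fun n ↦ ?_)
  have e0 := Complex.ne_zero_of_re_pos' hc
  have e1 := Complex.ne_zero_of_re_pos' hc1
  have e2 : c + 1 + n ≠ 0 := Complex.ne_zero_of_re_pos' (by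
    simp; linarith [Nat.cast_nonneg (α := ℝ) n])
  have h2 : (n : ℂ) + 1 ≠ 0 := by exact_mod_cast n.succ_ne_zero
  have h3 : (n.factorial : ℂ) ≠ 0 := by exact_mod_cast n.factorial_ne_zero
  have h4 := ascPochhammer_eval_ne_zero_of_re_pos hc1 n
  have h5 : (ascPochhammer ℂ n).eval (c + 2) =
      (ascPochhammer ℂ n).eval (c + 1) * (c + 1 + n) / (c + 1) := by
    rw [eq_div_iff e1, ← ascPochhammer_succ_eval, ascPochhammer_succ_eval_left, mul_comm]
    ring_nf
  simp only [ordinaryHypergeometricCoefficient, h5]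
  rw [ascPochhammer_succ_eval_left n a, ascPochhammer_succ_eval_left n b,
    ascPochhammer_succ_eval_left n c, ascPochhammer_succ_eval n (c + 1), Nat.factorial_succ]
  push_cast
  field_simp
  ring

/-- Contiguous relation lowering the second parameter. -/
theorem ordinaryHypergeometric_eq_add_one_mid (a b : ℂ) {c : ℂ} (hc : 0 < c.re) {z : ℂ}
    (hz : ‖z‖ < 1) :
    ordinaryHypergeometric a b c z = ordinaryHypergeometric a (b + 1) c z -
      z * (a / c) * ordinaryHypergeometric (a + 1) (b + 1) (c + 1) z := by
  have hc1 : 0 < (c + 1).re := by simp; linarith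
  have h := (hasSum_succ_ordinaryHypergeometric a (b + 1) hc hz).sub
    ((hasSum_ordinaryHypergeometric (a + 1) (b + 1) hc1 hz).mul_left (z * (a / c)))
  suffices ordinaryHypergeometric a b c z - 1 = ordinaryHypergeometric a (b + 1) c z - 1 -
      z * (a / c) * ordinaryHypergeometric (a + 1) (b + 1) (c + 1) z by
    linear_combination this
  refine (hasSum_succ_ordinaryHypergeometric a b hc hz).unique (h.congr_fun fun n ↦ ?_)
  have e0 := Complex.ne_zero_of_re_pos' hc
  have h2 : (n : ℂ) + 1 ≠ 0 := by exact_mod_cast n.succ_ne_zero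
  have h3 : (n.factorial : ℂ) ≠ 0 := by exact_mod_cast n.factorial_ne_zero
  have h4 := ascPochhammer_eval_ne_zero_of_re_pos hc1 n
  simp only [ordinaryHypergeometricCoefficient]
  rw [ascPochhammer_succ_eval_left n a, ascPochhammer_succ_eval_left n b,
    ascPochhammer_succ_eval_left n c, ascPochhammer_succ_eval n (b + 1), Nat.factorial_succ]
  push_cast
  field_simp
  ring

/-- The contiguous relation behind Pfaff's transformation. -/
theorem ordinaryHypergeometric_sub_one_sub_mul (a d : ℂ) {c : ℂ} (hc : 0 < c.re) {z : ℂ}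
    (hz : ‖z‖ < 1) :
    ordinaryHypergeometric a d c z -
        d / c * (1 - z) * ordinaryHypergeometric (a + 1) (d + 1) (c + 1) z =
      (c - d) / c * ordinaryHypergeometric (a + 1) d (c + 1) z := by
  have hc1 : 0 < (c + 1).re := by simp; linarith
  have e0 := Complex.ne_zero_of_re_pos' hc
  have h := ((hasSum_succ_ordinaryHypergeometric a d hc hz).sub
    ((hasSum_succ_ordinaryHypergeometric (a + 1) (d + 1) hc1 hz).mul_left (d / c))).add
    ((hasSum_ordinaryHypergeometric (a + 1) (d + 1) hc1 hz).mul_left (d / c * z))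
  suffices ordinaryHypergeometric a d c z - 1 -
      d / c * (ordinaryHypergeometric (a + 1) (d + 1) (c + 1) z - 1) +
      d / c * z * ordinaryHypergeometric (a + 1) (d + 1) (c + 1) z =
      (c - d) / c * (ordinaryHypergeometric (a + 1) d (c + 1) z - 1) by
    have e : (c - d) / c = 1 - d / c := by field_simp
    rw [e] at this ⊢
    linear_combination this
  refine h.unique (((hasSum_succ_ordinaryHypergeometric (a + 1) d hc1 hz).mul_left
    ((c - d) / c)).congr_fun fun n ↦ ?_)
  have h2 : (n : ℂ) + 1 ≠ 0 := by exact_mod_cast n.succ_ne_zero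
  have h3 : (n.factorial : ℂ) ≠ 0 := by exact_mod_cast n.factorial_ne_zero
  have h4 := ascPochhammer_eval_ne_zero_of_re_pos hc1 n
  have e2 : c + 1 + n ≠ 0 := Complex.ne_zero_of_re_pos' (by
    simp; linarith [Nat.cast_nonneg (α := ℝ) n])
  simp only [ordinaryHypergeometricCoefficient]
  rw [ascPochhammer_succ_eval_left n a, ascPochhammer_succ_eval_left n d,
    ascPochhammer_succ_eval_left n c, ascPochhammer_succ_eval n (a + 1),
    ascPochhammer_succ_eval n (d + 1), ascPochhammer_succ_eval n (c + 1), Nat.factorial_succ]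
  push_cast
  field_simp
  ring

/-- The Pochhammer symbols of b cancel and the binomial series remains. -/
theorem ordinaryHypergeometric_self_right (a : ℂ) {b : ℂ} (hb : 0 < b.re) {z : ℂ}
    (hz : ‖z‖ < 1) : ordinaryHypergeometric a b b z = (1 - z) ^ (-a) := by
  have hk : ∀ k : ℕ, (k : ℂ) ≠ -b := fun k hk ↦ by
    have := congrArg Complex.re hk
    simp only [Complex.natCast_re, Complex.neg_re] at this
    have := Nat.cast_nonneg (α := ℝ) k
    linarith
  have h := (Complex.one_add_cpow_hasFPowerSeriesOnBall_zero (a := -a)).hasSum (y := -z) (by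
    rw [Metric.mem_eball, edist_zero_right, enorm_neg, enorm_eq_nnnorm]
    exact_mod_cast hz)
  rw [binomialSeries_eq_ordinaryHypergeometricSeries hk, neg_neg] at h
  rw [zero_add, ← sub_eq_add_neg] at h
  refine (hasSum_ordinaryHypergeometric a b hb hz).unique (h.congr_fun fun n ↦ ?_)
  simp [FormalMultilinearSeries.compContinuousLinearMap, ordinaryHypergeometricSeries,
    FormalMultilinearSeries.ofScalars]

end HypergeometricSeries

/-! ### Pfaff's transformation and the reduction of Appell's F₃. -/

section Pfaff

/-- With (1 + X) q = 1 + e one has ‖e‖ < 1/8 + 1/8 + 1/64 < 1/2 < ‖1 + e‖, so e / (1 + e) lies in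
the unit disc. The value 1/8 is only a convenient choice. -/
theorem norm_one_sub_inv_mul_lt_one {X q : ℂ} (hX : ‖X‖ < 1 / 8) (hq : ‖q - 1‖ < 1 / 8) :
    (1 + X) * q ≠ 0 ∧ ‖1 - ((1 + X) * q)⁻¹‖ < 1 := by
  set e : ℂ := (1 + X) * q - 1 with he
  have h1 : ‖e‖ < 1 / 2 := by
    have : e = X + (q - 1) + X * (q - 1) := by rw [he]; ring
    rw [this]
    have h2 := norm_add₃_le (a := X) (b := q - 1) (c := X * (q - 1))
    rw [norm_mul] at h2
    have h3 : ‖X‖ * ‖q - 1‖ ≤ 1 / 8 * (1 / 8) := by gcongr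
    linarith
  have h2 : (1 + X) * q = 1 + e := by rw [he]; ring
  have h3 : 1 / 2 < ‖1 + e‖ := by
    have := norm_sub_norm_le (1 : ℂ) (-e)
    rw [norm_neg, norm_one, sub_neg_eq_add] at this
    linarith
  have h4 : 1 + e ≠ 0 := norm_pos_iff.mp (by linarith)
  rw [h2]
  refine ⟨h4, ?_⟩
  have : 1 - (1 + e)⁻¹ = e / (1 + e) := by field_simp; ring
  rw [this, norm_div, div_lt_one (by linarith)]
  linarith

/-- The derivative has the same shape with a and c raised by one, because the two terms of the
product rule combine through `ordinaryHypergeometric_sub_one_sub_mul`. Hence all derivatives are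
explicit. The free factor q lets one Taylor expansion serve both Pfaff (q = 1) and Appell (q = 1 +
Y). -/
theorem hasDerivAt_cpow_mul_ordinaryHypergeometric (a b : ℂ) {c : ℂ} (hc : 0 < c.re) {X q : ℂ}
    (hX : ‖X‖ < 1 / 8) (hq : ‖q - 1‖ < 1 / 8) :
    HasDerivAt (fun X ↦ (1 + X) ^ (-a) * ordinaryHypergeometric a b c (1 - ((1 + X) * q)⁻¹))
      (-(a * (c - b) / c) * ((1 + X) ^ (-(a + 1)) *
        ordinaryHypergeometric (a + 1) b (c + 1) (1 - ((1 + X) * q)⁻¹))) X := by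
  obtain ⟨hne, hlt⟩ := norm_one_sub_inv_mul_lt_one hX hq
  have hs : 1 + X ∈ Complex.slitPlane := Complex.mem_slitPlane_of_norm_lt_one (by linarith)
  have h0 : 1 + X ≠ 0 := Complex.slitPlane_ne_zero hs
  have hq0 : q ≠ 0 := right_ne_zero_of_mul hne
  have h1 : HasDerivAt (fun X : ℂ ↦ 1 + X) 1 X := (hasDerivAt_id X).const_add 1
  have h2 := h1.cpow_const (c := -a) hs
  have h3 : HasDerivAt (fun X : ℂ ↦ 1 - ((1 + X) * q)⁻¹) (-(-(1 * q) / ((1 + X) * q) ^ 2)) X :=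
    ((h1.mul_const q).fun_inv hne).const_sub 1
  have h4 := (hasDerivAt_ordinaryHypergeometric a b hc hlt).comp X h3
  refine (h2.mul h4).congr_deriv ?_
  have hC := ordinaryHypergeometric_sub_one_sub_mul a b hc hlt
  rw [sub_sub_cancel] at hC
  have hc0 := Complex.ne_zero_of_re_pos' hc
  have e1 : (1 + X) ^ (-a) = (1 + X) ^ (-(a + 1)) * (1 + X) := by
    nth_rewrite 3 [← Complex.cpow_one (1 + X)]
    rw [← Complex.cpow_add _ _ h0]; ring_nf
  have e2 : (1 + X) ^ (-a - 1) = (1 + X) ^ (-(a + 1)) := by ring_nf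
  simp only [Function.comp_apply]
  rw [e1, e2]
  generalize (1 + X) ^ (-(a + 1)) = P at *
  generalize ordinaryHypergeometric (a + 1) (b + 1) (c + 1) (1 - ((1 + X) * q)⁻¹) = F1 at *
  have e3 : (c - b) / c * ordinaryHypergeometric (a + 1) b (c + 1) (1 - ((1 + X) * q)⁻¹) =
    ordinaryHypergeometric a b c (1 - ((1 + X) * q)⁻¹) -
        b / c * ((1 + X) * q)⁻¹ * F1 := hC.symm
  have e4 : -(a * (c - b) / c) * (P *
      ordinaryHypergeometric (a + 1) b (c + 1) (1 - ((1 + X) * q)⁻¹)) =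
      -a * P * ((c - b) / c *
        ordinaryHypergeometric (a + 1) b (c + 1) (1 - ((1 + X) * q)⁻¹)) := by ring
  rw [e4, e3]
  generalize ordinaryHypergeometric a b c (1 - ((1 + X) * q)⁻¹) = F0
  field_simp
  ring

theorem iteratedDeriv_cpow_mul_ordinaryHypergeometric (a b : ℂ) {c : ℂ} (hc : 0 < c.re) {q : ℂ}
    (hq : ‖q - 1‖ < 1 / 8) (n : ℕ) {X : ℂ} (hX : ‖X‖ < 1 / 8) :
    iteratedDeriv n
        (fun X ↦ (1 + X) ^ (-a) * ordinaryHypergeometric a b c (1 - ((1 + X) * q)⁻¹)) X =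
      (-1) ^ n * ((ascPochhammer ℂ n).eval a * (ascPochhammer ℂ n).eval (c - b) *
        ((ascPochhammer ℂ n).eval c)⁻¹) *
        ((1 + X) ^ (-(a + n)) *
          ordinaryHypergeometric (a + n) b (c + n) (1 - ((1 + X) * q)⁻¹)) := by
  induction n generalizing X with
  | zero => simp
  | succ n ih =>
    rw [iteratedDeriv_succ]
    have hev : iteratedDeriv n
        (fun X ↦ (1 + X) ^ (-a) * ordinaryHypergeometric a b c (1 - ((1 + X) * q)⁻¹)) =ᶠ[𝓝 X]
        fun X ↦ (-1) ^ n * ((ascPochhammer ℂ n).eval a * (ascPochhammer ℂ n).eval (c - b) *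
        ((ascPochhammer ℂ n).eval c)⁻¹) *
        ((1 + X) ^ (-(a + n)) *
          ordinaryHypergeometric (a + n) b (c + n) (1 - ((1 + X) * q)⁻¹)) := by
      filter_upwards [Metric.isOpen_ball.mem_nhds (mem_ball_zero_iff.mpr hX)] with Y hY
      exact ih (mem_ball_zero_iff.mp hY)
    have hcn : 0 < (c + n).re := by simp; linarith [Nat.cast_nonneg (α := ℝ) n]
    rw [hev.deriv_eq, ((hasDerivAt_cpow_mul_ordinaryHypergeometric (a + n) b hcn hX
      hq).const_mul _).deriv, ascPochhammer_succ_eval, ascPochhammer_succ_eval,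
      ascPochhammer_succ_eval]
    have h1 := Complex.ne_zero_of_re_pos' hcn
    have h2 := ascPochhammer_eval_ne_zero_of_re_pos hc n
    push_cast
    rw [← add_assoc a, ← add_assoc c]
    field_simp
    ring

theorem hasSum_cpow_mul_ordinaryHypergeometric (a b : ℂ) {c : ℂ} (hc : 0 < c.re) {X q : ℂ}
    (hX : ‖X‖ < 1 / 8) (hq : ‖q - 1‖ < 1 / 8) :
    HasSum (fun n : ℕ ↦ ordinaryHypergeometricCoefficient a (c - b) c n * (-X) ^ n *
        ordinaryHypergeometric (a + n) b (c + n) (1 - q⁻¹))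
      ((1 + X) ^ (-a) * ordinaryHypergeometric a b c (1 - ((1 + X) * q)⁻¹)) := by
  have hd : DifferentiableOn ℂ
      (fun X ↦ (1 + X) ^ (-a) * ordinaryHypergeometric a b c (1 - ((1 + X) * q)⁻¹))
      (Metric.ball 0 (1 / 8)) := fun Y hY ↦
    (hasDerivAt_cpow_mul_ordinaryHypergeometric a b hc (mem_ball_zero_iff.mp hY)
      hq).differentiableAt.differentiableWithinAt
  refine (Complex.hasSum_taylorSeries_on_ball hd (mem_ball_zero_iff.mpr hX)).congr_fun fun n ↦ ?_
  rw [iteratedDeriv_cpow_mul_ordinaryHypergeometric a b hc hq n (by simp)]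
  simp only [ordinaryHypergeometricCoefficient, smul_eq_mul, sub_zero, add_zero, one_mul,
    Complex.one_cpow]
  rw [neg_pow]
  ring

/-- Pfaff's transformation near the origin. -/
theorem cpow_mul_ordinaryHypergeometric_one_sub_inv (a b : ℂ) {c : ℂ} (hc : 0 < c.re) {X : ℂ}
    (hX : ‖X‖ < 1 / 8) :
    (1 + X) ^ (-a) * ordinaryHypergeometric a b c (1 - (1 + X)⁻¹) =
      ordinaryHypergeometric a (c - b) c (-X) := by
  -- At q = 1 the inner hypergeometric factors are evaluated at 0, so only the coefficients remain.
  have h := hasSum_cpow_mul_ordinaryHypergeometric a b hc hX (q := 1) (by simp)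
  simp only [mul_one, inv_one, sub_self, ordinaryHypergeometric_zero] at h
  exact h.unique (hasSum_ordinaryHypergeometric a (c - b) hc (by rw [norm_neg]; linarith))

/-- The reduction of Appell's function `F₃(a, b, c - b, c - a; c)` to Gauss's function. -/
theorem hasSum_appell (a b : ℂ) {c : ℂ} (hc : 0 < c.re) {X Y : ℂ}
    (hX : ‖X‖ < 1 / 8) (hY : ‖Y‖ < 1 / 8) :
    HasSum (fun n : ℕ ↦ ordinaryHypergeometricCoefficient a (c - b) c n * (-X) ^ n *
        ordinaryHypergeometric b (c - a) (c + n) (-Y))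
      ((1 + X) ^ (-a) * (1 + Y) ^ (-b) *
        ordinaryHypergeometric a b c (1 - ((1 + X) * (1 + Y))⁻¹)) := by
  have h := (hasSum_cpow_mul_ordinaryHypergeometric a b hc hX (q := 1 + Y)
    (by simpa using hY)).mul_left ((1 + Y) ^ (-b))
  rw [← mul_assoc, mul_comm ((1 + Y) ^ (-b))] at h
  refine h.congr_fun fun n ↦ ?_
  have hcn : 0 < (c + n).re := by simp; linarith [Nat.cast_nonneg (α := ℝ) n]
  -- Pfaff in Y is applied to each Taylor coefficient; (c + n) - (a + n) = c - a, so the second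
  -- parameter is independent of n.
  have hP := cpow_mul_ordinaryHypergeometric_one_sub_inv b (a + n) hcn hY
  rw [ordinaryHypergeometric_comm b, add_sub_add_right_eq_sub] at hP
  rw [← hP]
  ring

end Pfaff

/-! ### Beta-weighted integrals over the unit interval. -/

section UnitIntervalIntegrals

/-- An integral over the unit interval of a kernel which is holomorphic in a parameter is
holomorphic in the parameter. -/
theorem differentiableOn_intervalIntegral_mul {w : ℝ → ℂ} (hw : IntervalIntegrable w volume 0 1)
    {U : Set ℂ} (hU : IsOpen U) {K : ℝ → ℂ → ℂ}
    (hK : ContinuousOn (fun p : ℝ × ℂ ↦ K p.1 p.2) (Icc 0 1 ×ˢ U))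
    (hd : ∀ s ∈ Icc (0 : ℝ) 1, DifferentiableOn ℂ (K s) U) :
    DifferentiableOn ℂ (fun z ↦ ∫ s in (0 : ℝ)..1, w s * K s z) U := by
  intro z₀ hz₀
  obtain ⟨ε, hε, hεU⟩ := Metric.isOpen_iff.mp hU z₀ hz₀
  -- Discs of radius r about points within r of z₀ stay in the closed disc of radius 2r < ε, so
  -- Cauchy's estimate bounds the derivative by M / r.
  set r := ε / 4 with hr
  have hr0 : 0 < r := by positivity
  have hsub : Metric.closedBall z₀ (2 * r) ⊆ U :=
    (Metric.closedBall_subset_ball (by linarith)).trans hεU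
  have hcpt : IsCompact (Icc (0 : ℝ) 1 ×ˢ Metric.closedBall z₀ (2 * r)) :=
    isCompact_Icc.prod (isCompact_closedBall _ _)
  obtain ⟨M, hM⟩ := hcpt.exists_bound_of_continuousOn (hK.mono (prod_mono_right hsub))
  have hI : Ι (0 : ℝ) 1 ⊆ Icc 0 1 := by
    rw [uIoc_of_le zero_le_one]; exact Ioc_subset_Icc_self
  have hKs : ∀ z ∈ U, ContinuousOn (fun s ↦ K s z) (Icc 0 1) := fun z hz ↦
    hK.comp (f := fun s : ℝ ↦ (s, z)) (by fun_prop) (fun s hs ↦ ⟨hs, hz⟩)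
  have hmeas : ∀ z ∈ U, AEStronglyMeasurable (fun s ↦ w s * K s z) (volume.restrict (Ι 0 1)) := by
    intro z hz
    exact hw.aestronglyMeasurable_restrict_uIoc.mul
      (((hKs z hz).mono hI).aestronglyMeasurable measurableSet_uIoc)
  have hderiv : ∀ s ∈ Ι (0 : ℝ) 1, ∀ z ∈ Metric.ball z₀ r,
      HasDerivAt (fun z ↦ w s * K s z) (w s * deriv (K s) z) z := by
    intro s hs z hz
    have hzU : z ∈ U := hsub (Metric.ball_subset_closedBall
      (Metric.ball_subset_ball (by linarith) hz))
    exact ((hd s (hI hs)).differentiableAt (hU.mem_nhds hzU)).hasDerivAt.const_mul _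
  have key := intervalIntegral.hasDerivAt_integral_of_dominated_loc_of_deriv_le
    (μ := volume) (a := 0) (b := 1) (F := fun z s ↦ w s * K s z)
    (F' := fun z s ↦ w s * deriv (K s) z) (bound := fun s ↦ ‖w s‖ * (M / r))
    (Metric.ball_mem_nhds z₀ hr0)
    (by filter_upwards [hU.mem_nhds hz₀] with z hz using hmeas z hz)
    (hw.mul_continuousOn (by rw [uIcc_of_le zero_le_one]; exact hKs z₀ hz₀))
    (by
      -- The derivative at z₀ is measurable in s as a limit of difference quotients along this
      -- sequence.
      set u : ℕ → ℂ := fun n ↦ z₀ + ((r / (n + 1 : ℝ) : ℝ) : ℂ)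
      have hu : ∀ n, u n ∈ Metric.closedBall z₀ (2 * r) := fun n ↦ by
        have h1 : (0 : ℝ) < n + 1 := by positivity
        simp only [u, Metric.mem_closedBall, dist_self_add_left, Complex.norm_real,
          Real.norm_eq_abs]
        rw [abs_of_pos (by positivity), div_le_iff₀ h1]
        nlinarith [Nat.cast_nonneg (α := ℝ) n]
      have hlim : Tendsto u atTop (𝓝[≠] z₀) := by
        rw [tendsto_nhdsWithin_iff]
        constructor
        · have h0 : Tendsto (fun n : ℕ ↦ r / (n + 1 : ℝ)) atTop (𝓝 0) :=
            tendsto_const_nhds.div_atTop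
              (tendsto_natCast_atTop_atTop.atTop_add tendsto_const_nhds)
          simpa [u] using ((Complex.continuous_ofReal.tendsto 0).comp h0).const_add z₀
        · refine Eventually.of_forall fun n ↦ ?_
          have h1 : (0 : ℝ) < r / (n + 1) := by positivity
          simpa [u] using (by exact_mod_cast h1.ne' : ((r / (n + 1 : ℝ) : ℝ) : ℂ) ≠ 0)
      refine aestronglyMeasurable_of_tendsto_ae atTop
        (f := fun n s ↦ slope (fun z ↦ w s * K s z) z₀ (u n)) (fun n ↦ ?_) ?_
      · simp only [slope_def_field]
        simp only [div_eq_mul_inv]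
        exact ((hmeas _ (hsub (hu n))).sub (hmeas _ hz₀)).mul_const _
      · filter_upwards [ae_restrict_mem measurableSet_uIoc] with s hs
        exact (hderiv s hs z₀ (Metric.mem_ball_self hr0)).tendsto_slope.comp hlim)
    (by
      refine Eventually.of_forall fun s hs z hz ↦ ?_
      rw [norm_mul]
      gcongr
      refine Complex.norm_deriv_le_of_forall_mem_sphere_norm_le hr0 ?_ fun y hy ↦ ?_
      · refine DifferentiableOn.diffContOnCl ((hd s (hI hs)).mono ?_)
        refine (closure_mono Metric.ball_subset_closedBall).trans ?_
        rw [Metric.isClosed_closedBall.closure_eq]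
        refine (Metric.closedBall_subset_closedBall' ?_).trans hsub
        linarith [Metric.mem_ball.mp hz]
      · refine hM (s, y) ⟨hI hs, ?_⟩
        have h1 := Metric.mem_ball.mp hz
        have h2 := Metric.mem_sphere.mp hy
        have h3 := dist_triangle y z z₀
        rw [Metric.mem_closedBall]
        linarith)
    (hw.norm.mul_const _)
    (Eventually.of_forall hderiv)
  exact key.2.differentiableAt.differentiableWithinAt

/-- Termwise integration of a power series against an integrable weight. -/
theorem hasSum_mul_intervalIntegral_pow {w : ℝ → ℂ} (hw : IntervalIntegrable w volume 0 1)
    {c : ℕ → ℂ} (hc : Summable fun n ↦ ‖c n‖) {f : ℝ → ℂ}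
    (hf : ∀ s ∈ Ioc (0 : ℝ) 1, HasSum (fun n ↦ c n * (s : ℂ) ^ n) (f s)) :
    HasSum (fun n ↦ c n * ∫ s in (0 : ℝ)..1, w s * (s : ℂ) ^ n)
      (∫ s in (0 : ℝ)..1, w s * f s) := by
  have h := intervalIntegral.hasSum_integral_of_dominated_convergence
    (μ := volume) (a := 0) (b := 1) (F := fun n s ↦ c n * (w s * (s : ℂ) ^ n))
    (f := fun s ↦ w s * f s) (fun n s ↦ ‖c n‖ * ‖w s‖)
    (fun n ↦ (hw.aestronglyMeasurable_restrict_uIoc.mul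
      (by fun_prop : Continuous fun s : ℝ ↦ (s : ℂ) ^ n).aestronglyMeasurable).const_mul _)
    (fun n ↦ Eventually.of_forall fun s hs ↦ by
      rw [uIoc_of_le zero_le_one] at hs
      rw [norm_mul, norm_mul, norm_pow, Complex.norm_real, Real.norm_eq_abs, abs_of_pos hs.1]
      gcongr
      exact mul_le_of_le_one_right (norm_nonneg _) (pow_le_one₀ hs.1.le hs.2))
    (Eventually.of_forall fun s _ ↦ hc.mul_right _)
    (by
      simp_rw [tsum_mul_right]
      exact hw.norm.const_mul _)
    (Eventually.of_forall fun s hs ↦ by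
      rw [uIoc_of_le zero_le_one] at hs
      refine ((hf s hs).mul_left (w s)).congr_fun fun n ↦ ?_
      ring)
  simpa only [intervalIntegral.integral_const_mul] using h

theorem Complex.Gamma_add_nat_eq {z : ℂ} (hz : 0 < z.re) (n : ℕ) :
    Complex.Gamma (z + n) = (ascPochhammer ℂ n).eval z * Complex.Gamma z := by
  induction n with
  | zero => simp
  | succ n ih =>
    have h0 : z + n ≠ 0 := Complex.ne_zero_of_re_pos' (by
      simp; linarith [Nat.cast_nonneg (α := ℝ) n])
    rw [ascPochhammer_succ_eval]
    push_cast
    rw [← add_assoc, Complex.Gamma_add_one _ h0, ih]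
    ring

theorem Complex.betaIntegral_add_nat {u v : ℂ} (hu : 0 < u.re) (hv : 0 < v.re) (n : ℕ) :
    Complex.betaIntegral (u + n) v = (ascPochhammer ℂ n).eval u *
      ((ascPochhammer ℂ n).eval (u + v))⁻¹ * Complex.betaIntegral u v := by
  have hn := Nat.cast_nonneg (α := ℝ) n
  have huv : 0 < (u + v).re := by simp; linarith
  have hun : 0 < (u + n).re := by simp; linarith
  rw [Complex.betaIntegral_eq_Gamma_mul_div _ _ hun hv,
    Complex.betaIntegral_eq_Gamma_mul_div _ _ hu hv, add_right_comm,
    Complex.Gamma_add_nat_eq hu, Complex.Gamma_add_nat_eq huv]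
  have h1 := ascPochhammer_eval_ne_zero_of_re_pos huv n
  have h2 := Complex.Gamma_ne_zero_of_re_pos huv
  field_simp

theorem intervalIntegral_beta_mul_pow (u v : ℂ) (n : ℕ) :
    ∫ s in (0 : ℝ)..1, ((s : ℂ) ^ (u - 1) * (1 - (s : ℂ)) ^ (v - 1)) * (s : ℂ) ^ n =
      Complex.betaIntegral (u + n) v := by
  rw [Complex.betaIntegral]
  refine intervalIntegral.integral_congr_ae (Eventually.of_forall fun s hs ↦ ?_)
  rw [uIoc_of_le zero_le_one] at hs
  have h0 : (s : ℂ) ≠ 0 := by exact_mod_cast hs.1.ne'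
  rw [add_sub_right_comm, Complex.cpow_add _ _ h0, Complex.cpow_natCast]
  ring

/-- Bateman's integral for Gauss's hypergeometric function. -/
theorem intervalIntegral_beta_mul_ordinaryHypergeometric (a b : ℂ) {c p : ℂ} (hc : 0 < c.re)
    (hp : 0 < p.re) {z : ℂ} (hz : ‖z‖ < 1) :
    ∫ s in (0 : ℝ)..1, ((s : ℂ) ^ (c - 1) * (1 - (s : ℂ)) ^ (p - 1)) *
        ordinaryHypergeometric a b c (s * z) =
      Complex.betaIntegral c p * ordinaryHypergeometric a b (c + p) z := by
  have h := hasSum_mul_intervalIntegral_pow (Complex.betaIntegral_convergent hc hp)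
    (summable_norm_ordinaryHypergeometric a b hc hz)
    (f := fun s ↦ ordinaryHypergeometric a b c (s * z)) (fun s hs ↦ by
      have hsz : ‖(s : ℂ) * z‖ < 1 := by
        rw [norm_mul, Complex.norm_real, Real.norm_eq_abs, abs_of_pos hs.1]
        exact (mul_le_of_le_one_left (norm_nonneg z) hs.2).trans_lt hz
      refine (hasSum_ordinaryHypergeometric a b hc hsz).congr_fun fun n ↦ ?_
      rw [mul_pow]
      ring)
  have hcp : 0 < (c + p).re := by simp; linarith
  refine h.unique (((hasSum_ordinaryHypergeometric a b hcp hz).mul_left _).congr_fun fun n ↦ ?_)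
  -- The n-th moment of the beta weight replaces (c)_n by (c + p)_n in the denominator.
  rw [intervalIntegral_beta_mul_pow, Complex.betaIntegral_add_nat hc hp]
  have h1 := ascPochhammer_eval_ne_zero_of_re_pos hc n
  simp only [ordinaryHypergeometricCoefficient]
  field_simp

end UnitIntervalIntegrals

/-! ### Polynomial bounds along rays. -/

section PolynomialGrowth

/-- `g` is bounded by a polynomial on `[0, ∞)`. -/
def HasPolynomialGrowth (g : ℝ → ℂ) : Prop :=
  ∃ (C : ℝ) (M : ℕ), 0 ≤ C ∧ ∀ u : ℝ, 0 ≤ u → ‖g u‖ ≤ C * (1 + u) ^ M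

theorem HasPolynomialGrowth.const (c : ℂ) : HasPolynomialGrowth fun _ ↦ c :=
  ⟨‖c‖, 0, norm_nonneg c, fun u _ ↦ by simp⟩

theorem HasPolynomialGrowth.ofReal : HasPolynomialGrowth fun u ↦ (u : ℂ) :=
  ⟨1, 1, zero_le_one, fun u hu ↦ by
    rw [Complex.norm_real, Real.norm_eq_abs, abs_of_nonneg hu]; linarith⟩

theorem HasPolynomialGrowth.add {f g : ℝ → ℂ} (hf : HasPolynomialGrowth f)
    (hg : HasPolynomialGrowth g) : HasPolynomialGrowth fun u ↦ f u + g u := by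
  obtain ⟨C, M, hC, h⟩ := hf
  obtain ⟨D, N, hD, h'⟩ := hg
  refine ⟨C + D, M + N, by positivity, fun u hu ↦ ?_⟩
  have h1 : (1 : ℝ) ≤ 1 + u := by linarith
  have h2 : (1 + u) ^ M ≤ (1 + u) ^ (M + N) := pow_le_pow_right₀ h1 (Nat.le_add_right M N)
  have h3 : (1 + u) ^ N ≤ (1 + u) ^ (M + N) := pow_le_pow_right₀ h1 (Nat.le_add_left N M)
  calc ‖f u + g u‖ ≤ C * (1 + u) ^ M + D * (1 + u) ^ N :=
        (norm_add_le _ _).trans (add_le_add (h u hu) (h' u hu))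
    _ ≤ C * (1 + u) ^ (M + N) + D * (1 + u) ^ (M + N) := by gcongr
    _ = _ := by ring

theorem HasPolynomialGrowth.mul {f g : ℝ → ℂ} (hf : HasPolynomialGrowth f)
    (hg : HasPolynomialGrowth g) : HasPolynomialGrowth fun u ↦ f u * g u := by
  obtain ⟨C, M, hC, h⟩ := hf
  obtain ⟨D, N, hD, h'⟩ := hg
  refine ⟨C * D, M + N, by positivity, fun u hu ↦ ?_⟩
  rw [norm_mul]
  calc ‖f u‖ * ‖g u‖ ≤ (C * (1 + u) ^ M) * (D * (1 + u) ^ N) := by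
        gcongr
        exacts [h u hu, h' u hu]
    _ = _ := by ring

theorem HasPolynomialGrowth.conj {f : ℝ → ℂ} (hf : HasPolynomialGrowth f) :
    HasPolynomialGrowth fun u ↦ (starRingEnd ℂ) (f u) := by
  obtain ⟨C, M, hC, h⟩ := hf
  exact ⟨C, M, hC, fun u hu ↦ by rw [RCLike.norm_conj]; exact h u hu⟩

theorem one_add_mul_mem_slitPlane {y : ℂ} (hy : y ∈ Complex.slitPlane) {u : ℝ} (hu : 0 ≤ u) :
    1 + (u : ℂ) * y ∈ Complex.slitPlane := by
  rcases hu.eq_or_lt with rfl | hu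
  · simp
  rw [Complex.mem_slitPlane_iff] at hy ⊢
  simp only [Complex.add_re, Complex.one_re, Complex.re_ofReal_mul, Complex.add_im,
    Complex.one_im, Complex.im_ofReal_mul, zero_add]
  rcases hy with hy | hy
  · left; positivity
  · right; exact mul_ne_zero hu.ne' hy

theorem exists_le_norm_one_add_mul {y : ℂ} (hy : y ∈ Complex.slitPlane) :
    ∃ δ : ℝ, 0 < δ ∧ ∀ u : ℝ, 0 ≤ u → δ ≤ ‖1 + (u : ℂ) * y‖ := by
  by_cases h : 0 ≤ y.re
  · refine ⟨1, one_pos, fun u hu ↦ ?_⟩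
    refine le_trans ?_ (Complex.re_le_norm _)
    simp only [Complex.add_re, Complex.one_re, Complex.re_ofReal_mul]
    nlinarith
  · have him : y.im ≠ 0 := by
      rcases Complex.mem_slitPlane_iff.mp hy with h' | h'
      · exact absurd h'.le h
      · exact h'
    have hy0 : 0 < ‖y‖ := norm_pos_iff.mpr (Complex.slitPlane_ne_zero hy)
    refine ⟨|y.im| / ‖y‖, by positivity, fun u hu ↦ ?_⟩
    rw [div_le_iff₀ hy0, ← RCLike.norm_conj y, ← norm_mul]
    -- Multiplication by conj y makes u * |y|² real, so the imaginary part no longer depends on u: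
    -- |Im y| / ‖y‖ is the distance from 0 to the line containing the ray.
    have := Complex.abs_im_le_norm ((1 + (u : ℂ) * y) * (starRingEnd ℂ) y)
    have e : ((1 + (u : ℂ) * y) * (starRingEnd ℂ) y).im = -y.im := by
      simp; ring
    rwa [e, abs_neg] at this

/-- The argument contributes at most exp(π |Im p|). Large values of ‖1 + uy‖ are at most linear in
u, and small ones are bounded below by `exists_le_norm_one_add_mul`, which controls negative Re p.
-/
theorem hasPolynomialGrowth_one_add_mul_cpow {y : ℂ} (hy : y ∈ Complex.slitPlane) (p : ℂ) :
    HasPolynomialGrowth fun u ↦ (1 + (u : ℂ) * y) ^ p := by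
  obtain ⟨δ, hδ, hle⟩ := exists_le_norm_one_add_mul hy
  obtain ⟨N, hN⟩ := exists_nat_ge |p.re|
  set E := Real.exp (Real.pi * |p.im|)
  refine ⟨((1 + ‖y‖) ^ N + (max 1 δ⁻¹) ^ N) * E, N, by positivity, fun u hu ↦ ?_⟩
  set w := 1 + (u : ℂ) * y with hw
  have hw0 : 0 < ‖w‖ := hδ.trans_le (hle u hu)
  have h1 : ‖w ^ p‖ ≤ ‖w‖ ^ p.re * E := by
    rw [Complex.norm_cpow_of_ne_zero (norm_pos_iff.mp hw0), div_eq_mul_inv, ← Real.exp_neg]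
    gcongr
    refine Real.exp_le_exp.mpr ((neg_le_abs (w.arg * p.im)).trans ?_)
    rw [abs_mul]
    gcongr
    exact Complex.abs_arg_le_pi w
  have h2 : ‖w‖ ≤ (1 + ‖y‖) * (1 + u) := by
    refine (norm_add_le _ _).trans ?_
    rw [norm_mul, norm_one, Complex.norm_real, Real.norm_eq_abs, abs_of_nonneg hu]
    nlinarith [norm_nonneg y]
  have h3 : ‖w‖ ^ p.re ≤ ((1 + ‖y‖) ^ N + (max 1 δ⁻¹) ^ N) * (1 + u) ^ N := by
    have hu1 : (1 : ℝ) ≤ (1 + u) ^ N := one_le_pow₀ (by linarith)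
    rcases le_total 1 ‖w‖ with h | h
    · calc ‖w‖ ^ p.re ≤ ‖w‖ ^ (N : ℝ) :=
            Real.rpow_le_rpow_of_exponent_le h ((le_abs_self _).trans hN)
        _ = ‖w‖ ^ N := Real.rpow_natCast _ _
        _ ≤ ((1 + ‖y‖) * (1 + u)) ^ N := by gcongr
        _ = (1 + ‖y‖) ^ N * (1 + u) ^ N := mul_pow _ _ _
        _ ≤ _ := by
          gcongr
          have : (0 : ℝ) ≤ (max 1 δ⁻¹) ^ N := by positivity
          linarith
    · calc ‖w‖ ^ p.re ≤ ‖w‖ ^ (-(N : ℝ)) :=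
            Real.rpow_le_rpow_of_exponent_ge hw0 h (by linarith [neg_abs_le p.re])
        _ = (‖w‖⁻¹) ^ N := by rw [Real.rpow_neg hw0.le, Real.rpow_natCast, inv_pow]
        _ ≤ (max 1 δ⁻¹) ^ N := by
          gcongr
          refine le_trans ?_ (le_max_right _ _)
          exact inv_anti₀ hδ (hle u hu)
        _ ≤ ((1 + ‖y‖) ^ N + (max 1 δ⁻¹) ^ N) * 1 := by
          have : (0 : ℝ) ≤ (1 + ‖y‖) ^ N := by positivity
          linarith
        _ ≤ _ := by gcongr
  calc ‖w ^ p‖ ≤ ‖w‖ ^ p.re * E := h1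
    _ ≤ ((1 + ‖y‖) ^ N + (max 1 δ⁻¹) ^ N) * (1 + u) ^ N * E := by gcongr
    _ = _ := by ring

end PolynomialGrowth

/-! ### Laplace transforms and convolution. -/

section LaplaceTransform

/-- The integrand of the Laplace transform of `u ^ (p - 1) * g u`. -/
noncomputable def laplaceIntegrand (p : ℂ) (g : ℝ → ℂ) (t u : ℝ) : ℂ :=
  ((Real.exp (-(t * u)) : ℝ) : ℂ) * ((u : ℂ) ^ (p - 1) * g u)

theorem integrableOn_laplaceIntegrand {p : ℂ} (hp : 0 < p.re) {g : ℝ → ℂ}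
    (hg : HasPolynomialGrowth g) (hc : ContinuousOn g (Ioi 0)) {t : ℝ} (ht : 0 < t) :
    IntegrableOn (laplaceIntegrand p g t) (Ioi 0) := by
  obtain ⟨C, M, hC, h⟩ := hg
  have h1 := integrableOn_rpow_mul_exp_neg_mul_rpow (p := 1) (s := p.re - 1) (b := t)
    (by linarith) one_pos ht
  have h2 := integrableOn_rpow_mul_exp_neg_mul_rpow (p := 1) (s := p.re - 1 + M) (b := t)
    (by linarith [Nat.cast_nonneg (α := ℝ) M]) one_pos ht
  -- From (1 + u)^M ≤ 2^(M-1) (1 + u^M), which also holds at M = 0 with truncated subtraction; two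
  -- Gamma integrals then dominate.
  refine Integrable.mono' ((h1.add h2).const_mul (C * 2 ^ (M - 1))) ?_ ?_
  · refine ContinuousOn.aestronglyMeasurable ?_ measurableSet_Ioi
    refine ContinuousOn.mul (by fun_prop) (ContinuousOn.mul ?_ hc)
    exact fun u hu ↦ (Complex.continuousAt_ofReal_cpow_const u _
      (Or.inr (ne_of_gt hu))).continuousWithinAt
  · filter_upwards [ae_restrict_mem measurableSet_Ioi] with u hu
    have hu' : 0 < u := hu
    rw [laplaceIntegrand, norm_mul, norm_mul, Complex.norm_real, Real.norm_eq_abs, Real.abs_exp,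
      Complex.norm_cpow_eq_rpow_re_of_pos hu']
    simp only [Complex.sub_re, Complex.one_re, Pi.add_apply, Real.rpow_one]
    rw [Real.rpow_add hu', Real.rpow_natCast]
    calc Real.exp (-(t * u)) * (u ^ (p.re - 1) * ‖g u‖)
        ≤ Real.exp (-(t * u)) * (u ^ (p.re - 1) * (C * (2 ^ (M - 1) * (1 ^ M + u ^ M)))) := by
          gcongr
          refine (h u hu'.le).trans ?_
          gcongr
          exact add_pow_le zero_le_one hu'.le M
      _ = _ := by rw [one_pow, neg_mul]; ring

theorem integral_laplaceIntegrand_one {p : ℂ} (hp : 0 < p.re) {t : ℝ} (ht : 0 < t) :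
    ∫ u in Ioi (0 : ℝ), laplaceIntegrand p (fun _ ↦ 1) t u =
      (t : ℂ) ^ (-p) * Complex.Gamma p := by
  have h := Complex.integral_cpow_mul_exp_neg_mul_Ioi hp ht
  have e : (1 / (t : ℂ)) ^ p = (t : ℂ) ^ (-p) := by
    rw [one_div, Complex.inv_cpow _ _ (by
      rw [Complex.arg_ofReal_of_nonneg ht.le]; exact Real.pi_pos.ne), Complex.cpow_neg]
  rw [← e, ← h]
  refine integral_congr_ae (Eventually.of_forall fun u ↦ ?_)
  simp only [laplaceIntegrand, mul_one]
  push_cast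
  ring

/-- Substituting r = s * u extracts u^{p+q-1} and leaves a beta weight on a fixed interval, a form
in which u can later be made complex. -/
theorem intervalIntegral_laplaceIntegrand_mul (p q : ℂ) (f g : ℝ → ℂ) (t : ℝ) {u : ℝ}
    (hu : 0 < u) :
    ∫ r in (0 : ℝ)..u, laplaceIntegrand p f t r * laplaceIntegrand q g t (u - r) =
      laplaceIntegrand (p + q) (fun u ↦ ∫ s in (0 : ℝ)..1,
        ((s : ℂ) ^ (p - 1) * (1 - (s : ℂ)) ^ (q - 1)) * (f (s * u) * g ((1 - s) * u))) t u := by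
  have h := intervalIntegral.integral_comp_mul_right (a := 0) (b := 1)
    (fun r ↦ laplaceIntegrand p f t r * laplaceIntegrand q g t (u - r)) hu.ne'
  rw [zero_mul, one_mul, eq_inv_smul_iff₀ hu.ne'] at h
  rw [← h, laplaceIntegrand, ← mul_assoc, Complex.real_smul,
    ← intervalIntegral.integral_const_mul, ← intervalIntegral.integral_const_mul]
  refine intervalIntegral.integral_congr_ae (Eventually.of_forall fun s hs ↦ ?_)
  rw [uIoc_of_le zero_le_one] at hs
  have hu0 : (u : ℂ) ≠ 0 := by exact_mod_cast hu.ne'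
  have e1 : u - s * u = (1 - s) * u := by ring
  have e2 : Real.exp (-(t * (s * u))) * Real.exp (-(t * ((1 - s) * u))) = Real.exp (-(t * u)) := by
    rw [← Real.exp_add]; ring_nf
  have e3 : (u : ℂ) ^ (p + q - 1) = u * ((u : ℂ) ^ (p - 1) * (u : ℂ) ^ (q - 1)) := by
    rw [← Complex.cpow_add _ _ hu0]
    nth_rewrite 2 [← Complex.cpow_one (u : ℂ)]
    rw [← Complex.cpow_add _ _ hu0]
    ring_nf
  have e4 : (1 - (s : ℂ)) = ((1 - s : ℝ) : ℂ) := by push_cast; rfl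
  rw [e1, laplaceIntegrand, laplaceIntegrand, ← e2, e3, e4, Complex.ofReal_mul s u,
    Complex.ofReal_mul (1 - s) u, Complex.ofReal_mul (Real.exp _),
    Complex.mul_cpow_ofReal_nonneg hs.1.le hu.le,
    Complex.mul_cpow_ofReal_nonneg (sub_nonneg.mpr hs.2) hu.le]
  ring

/-- The Laplace transform turns (rescaled) convolutions into products. -/
theorem integral_laplaceIntegrand_convolution {p q : ℂ} {f g : ℝ → ℂ} {t : ℝ}
    (hf : IntegrableOn (laplaceIntegrand p f t) (Ioi 0))
    (hg : IntegrableOn (laplaceIntegrand q g t) (Ioi 0)) :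
    IntegrableOn (laplaceIntegrand (p + q) (fun u ↦ ∫ s in (0 : ℝ)..1,
        ((s : ℂ) ^ (p - 1) * (1 - (s : ℂ)) ^ (q - 1)) * (f (s * u) * g ((1 - s) * u))) t)
      (Ioi 0) ∧
    ∫ u in Ioi (0 : ℝ), laplaceIntegrand (p + q) (fun u ↦ ∫ s in (0 : ℝ)..1,
        ((s : ℂ) ^ (p - 1) * (1 - (s : ℂ)) ^ (q - 1)) * (f (s * u) * g ((1 - s) * u))) t u =
      (∫ u in Ioi (0 : ℝ), laplaceIntegrand p f t u) *
        ∫ u in Ioi (0 : ℝ), laplaceIntegrand q g t u := by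
  constructor
  · refine (integrable_posConvolution hf hg (ContinuousLinearMap.mul ℝ ℂ)).integrableOn.congr_fun
      (fun u hu ↦ ?_) measurableSet_Ioi
    rw [posConvolution, indicator_of_mem hu]
    exact intervalIntegral_laplaceIntegrand_mul p q f g t hu
  · refine Eq.trans (setIntegral_congr_fun measurableSet_Ioi fun u hu ↦ ?_)
      (integral_posConvolution hf hg (ContinuousLinearMap.mul ℝ ℂ))
    exact (intervalIntegral_laplaceIntegrand_mul p q f g t hu).symm

end LaplaceTransform

/-! ### Continuation of ₂F₁ to the cut plane and its Laplace transform along rays. -/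

section SlitExtension

/-- The plane cut along `[1, ∞)`. -/
def hypergeometricDomain : Set ℂ := {z | 1 - z ∈ Complex.slitPlane}

theorem isOpen_hypergeometricDomain : IsOpen hypergeometricDomain :=
  Complex.isOpen_slitPlane.preimage (by fun_prop)

theorem mul_mem_hypergeometricDomain {z : ℂ} (hz : z ∈ hypergeometricDomain) {s : ℝ}
    (hs : s ∈ Icc (0 : ℝ) 1) : (s : ℂ) * z ∈ hypergeometricDomain := by
  have h := Complex.starConvex_one_slitPlane.add_smul_mem (y := -z)
    (by rw [← sub_eq_add_neg]; exact hz) hs.1 hs.2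
  rw [Complex.real_smul, mul_neg, ← sub_eq_add_neg] at h
  exact h

theorem isPreconnected_hypergeometricDomain : IsPreconnected hypergeometricDomain := by
  have h : StarConvex ℝ 0 hypergeometricDomain := by
    rw [starConvex_zero_iff]
    intro z hz s hs0 hs1
    rw [Complex.real_smul]
    exact mul_mem_hypergeometricDomain hz ⟨hs0, hs1⟩
  exact (h.isPathConnected (by simp [hypergeometricDomain])).isConnected.isPreconnected

theorem neg_mul_mem_hypergeometricDomain {y : ℂ} (hy : y ∈ Complex.slitPlane) {u : ℝ}
    (hu : 0 ≤ u) : -((u : ℂ) * y) ∈ hypergeometricDomain := by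
  have := one_add_mul_mem_slitPlane hy hu
  rwa [hypergeometricDomain, mem_ofPred_eq, sub_neg_eq_add]

/-- `φ` is the holomorphic extension of `₂F₁(a, b; c; ·)` to the plane cut along `[1, ∞)`. -/
structure IsSlitExtension (a b c : ℂ) (φ : ℂ → ℂ) : Prop where
  differentiableOn : DifferentiableOn ℂ φ hypergeometricDomain
  eq_series : ∀ z : ℂ, ‖z‖ < 1 → φ z = ordinaryHypergeometric a b c z

theorem IsSlitExtension.eqOn_deriv {a b c : ℂ} (hc : 0 < c.re) {φ ψ : ℂ → ℂ}
    (hφ : IsSlitExtension a b c φ) (hψ : IsSlitExtension (a + 1) (b + 1) (c + 1) ψ) :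
    EqOn (deriv φ) (fun z ↦ a * b / c * ψ z) hypergeometricDomain := by
  have h1 : AnalyticOnNhd ℂ (deriv φ) hypergeometricDomain :=
    (hφ.differentiableOn.analyticOnNhd isOpen_hypergeometricDomain).deriv
  have h2 : AnalyticOnNhd ℂ (fun z ↦ a * b / c * ψ z) hypergeometricDomain :=
    (hψ.differentiableOn.const_mul _).analyticOnNhd isOpen_hypergeometricDomain
  refine h1.eqOn_of_preconnected_of_eventuallyEq h2 isPreconnected_hypergeometricDomain
    (z₀ := 0) (by simp [hypergeometricDomain]) ?_
  filter_upwards [Metric.ball_mem_nhds (0 : ℂ) one_pos] with z hz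
  have hz' : ‖z‖ < 1 := by simpa using hz
  rw [hψ.eq_series z hz', ← (hasDerivAt_ordinaryHypergeometric a b hc hz').deriv]
  refine EventuallyEq.deriv_eq ?_
  filter_upwards [Metric.isOpen_ball.mem_nhds hz] with w hw
  exact hφ.eq_series w (by simpa using hw)

theorem IsSlitExtension.continuousOn_comp {a b c : ℂ} {φ : ℂ → ℂ} (hφ : IsSlitExtension a b c φ)
    {y : ℂ} (hy : y ∈ Complex.slitPlane) :
    ContinuousOn (fun u : ℝ ↦ φ (-((u : ℂ) * y))) (Ici 0) :=
  hφ.differentiableOn.continuousOn.comp (f := fun u : ℝ ↦ -((u : ℂ) * y)) (by fun_prop)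
    fun _ hu ↦ neg_mul_mem_hypergeometricDomain hy hu

theorem continuousOn_one_sub_mul_cpow (a : ℂ) :
    ContinuousOn (fun p : ℝ × ℂ ↦ (1 - (p.1 : ℂ) * p.2) ^ (-a))
      (Icc 0 1 ×ˢ hypergeometricDomain) :=
  ContinuousOn.cpow_const (by fun_prop) fun _ hp ↦ mul_mem_hypergeometricDomain hp.2 hp.1

theorem continuousOn_one_add_mul_cpow {y : ℂ} (hy : y ∈ Complex.slitPlane) (a : ℂ) :
    ContinuousOn (fun u : ℝ ↦ (1 + (u : ℂ) * y) ^ a) (Ici 0) :=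
  ContinuousOn.cpow_const (by fun_prop) fun _ hu ↦ one_add_mul_mem_slitPlane hy hu

/-- Euler's integral. -/
noncomputable def eulerIntegral (a b c z : ℂ) : ℂ :=
  ∫ s in (0 : ℝ)..1, ((s : ℂ) ^ (b - 1) * (1 - (s : ℂ)) ^ (c - b - 1)) *
    (1 - (s : ℂ) * z) ^ (-a)

theorem isSlitExtension_eulerIntegral (a : ℂ) {b c : ℂ} (hb : 0 < b.re) (hbc : 0 < (c - b).re) :
    IsSlitExtension a b c
      (fun z ↦ (Complex.betaIntegral b (c - b))⁻¹ * eulerIntegral a b c z) where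
  differentiableOn := by
    refine DifferentiableOn.const_mul ?_ _
    refine differentiableOn_intervalIntegral_mul (Complex.betaIntegral_convergent hb hbc)
      isOpen_hypergeometricDomain (continuousOn_one_sub_mul_cpow a) fun s hs ↦ ?_
    exact DifferentiableOn.cpow_const (by fun_prop) fun z hz ↦ mul_mem_hypergeometricDomain hz hs
  eq_series z hz := by
    have h := intervalIntegral_beta_mul_ordinaryHypergeometric a b hb hbc hz
    have hB : Complex.betaIntegral b (c - b) ≠ 0 := by
      rw [Complex.betaIntegral_eq_Gamma_mul_div _ _ hb hbc, add_sub_cancel]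
      have hc : 0 < c.re := by simp at hbc; linarith
      exact div_ne_zero (mul_ne_zero (Complex.Gamma_ne_zero_of_re_pos hb)
        (Complex.Gamma_ne_zero_of_re_pos hbc)) (Complex.Gamma_ne_zero_of_re_pos hc)
    rw [add_sub_cancel] at h
    rw [inv_mul_eq_iff_eq_mul₀ hB, ← h, eulerIntegral]
    refine intervalIntegral.integral_congr_ae (Eventually.of_forall fun s hs ↦ ?_)
    rw [uIoc_of_le zero_le_one] at hs
    have hsz : ‖(s : ℂ) * z‖ < 1 := by
      rw [norm_mul, Complex.norm_real, Real.norm_eq_abs, abs_of_pos hs.1]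
      exact (mul_le_of_le_one_left (norm_nonneg z) hs.2).trans_lt hz
    rw [ordinaryHypergeometric_self_right a hb hsz]

theorem hasPolynomialGrowth_eulerIntegral (a : ℂ) {b c : ℂ} (hb : 0 < b.re)
    (hbc : 0 < (c - b).re) {y : ℂ} (hy : y ∈ Complex.slitPlane) :
    HasPolynomialGrowth fun u ↦ eulerIntegral a b c (-((u : ℂ) * y)) := by
  obtain ⟨C, M, hC, h⟩ := hasPolynomialGrowth_one_add_mul_cpow hy (-a)
  have hw := Complex.betaIntegral_convergent hb hbc
  set w : ℝ → ℂ := fun s ↦ (s : ℂ) ^ (b - 1) * (1 - (s : ℂ)) ^ (c - b - 1) with hwdef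
  have hw0 : 0 ≤ ∫ s in (0 : ℝ)..1, ‖w s‖ :=
    intervalIntegral.integral_nonneg zero_le_one fun s _ ↦ norm_nonneg _
  refine ⟨(∫ s in (0 : ℝ)..1, ‖w s‖) * C, M, by positivity, fun u hu ↦ ?_⟩
  rw [mul_assoc, ← intervalIntegral.integral_mul_const]
  refine intervalIntegral.norm_integral_le_of_norm_le zero_le_one
    (Eventually.of_forall fun s hs ↦ ?_) (hw.norm.mul_const _)
  rw [norm_mul]
  have hsu : 0 ≤ s * u := mul_nonneg hs.1.le hu
  have h1 := h (s * u) hsu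
  have e : 1 - (s : ℂ) * -((u : ℂ) * y) = 1 + ((s * u : ℝ) : ℂ) * y := by push_cast; ring
  rw [e]
  refine mul_le_mul_of_nonneg_left (h1.trans ?_) (norm_nonneg _)
  gcongr
  exact mul_le_of_le_one_left hu hs.2

/-- Along a ray Euler's integral is the rescaled convolution of u^{b-1} (1 + uy)^{-a} with
u^{c-b-1}. -/
theorem integral_laplaceIntegrand_eulerIntegral (a : ℂ) {b c : ℂ} (hb : 0 < b.re)
    (hbc : 0 < (c - b).re) {y : ℂ} (hy : y ∈ Complex.slitPlane) {t : ℝ} (ht : 0 < t) :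
    ∫ u in Ioi (0 : ℝ), laplaceIntegrand c (fun u ↦ eulerIntegral a b c (-((u : ℂ) * y))) t u =
      (∫ u in Ioi (0 : ℝ), laplaceIntegrand b (fun u ↦ (1 + (u : ℂ) * y) ^ (-a)) t u) *
        ((t : ℂ) ^ (-(c - b)) * Complex.Gamma (c - b)) := by
  have h := (integral_laplaceIntegrand_convolution
    (integrableOn_laplaceIntegrand hb (hasPolynomialGrowth_one_add_mul_cpow hy (-a))
      ((continuousOn_one_add_mul_cpow hy (-a)).mono Ioi_subset_Ici_self) ht)
    (integrableOn_laplaceIntegrand hbc (HasPolynomialGrowth.const 1) continuousOn_const ht)).2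
  rw [integral_laplaceIntegrand_one hbc ht, add_sub_cancel] at h
  rw [← h]
  refine integral_congr_ae (Eventually.of_forall fun u ↦ ?_)
  simp only [laplaceIntegrand, eulerIntegral, mul_one]
  congr 2
  refine intervalIntegral.integral_congr fun s _ ↦ ?_
  simp only [mul_neg, sub_neg_eq_add]
  push_cast
  rw [mul_assoc (s : ℂ)]

/-- Integration by parts for the Laplace transform. -/
theorem integral_laplaceIntegrand_add_one {c : ℂ} (hc : 0 < c.re) {f g : ℝ → ℂ}
    (hf : HasPolynomialGrowth f) (hg : HasPolynomialGrowth g) (hfc : ContinuousOn f (Ici 0))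
    (hgc : ContinuousOn g (Ioi 0))
    (hd : ∀ u : ℝ, 0 < u →
      HasDerivAt (fun u : ℝ ↦ (u : ℂ) ^ c * f u) (c * ((u : ℂ) ^ (c - 1) * g u)) u)
    {t : ℝ} (ht : 0 < t) :
    c * ∫ u in Ioi (0 : ℝ), laplaceIntegrand c g t u =
      t * ∫ u in Ioi (0 : ℝ), laplaceIntegrand (c + 1) f t u := by
  have hc1 : 0 < (c + 1).re := by simp; linarith
  have hI1 := integrableOn_laplaceIntegrand hc hg hgc ht
  have hI2 := integrableOn_laplaceIntegrand hc1 hf (hfc.mono Ioi_subset_Ici_self) ht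
  have hder : ∀ u ∈ Ioi (0 : ℝ), HasDerivAt (laplaceIntegrand (c + 1) f t)
      (c * laplaceIntegrand c g t u - t * laplaceIntegrand (c + 1) f t u) u := by
    intro u hu
    have h1 : HasDerivAt (fun u : ℝ ↦ ((Real.exp (-(t * u)) : ℝ) : ℂ))
        ((Real.exp (-(t * u)) * -(t * 1) : ℝ) : ℂ) u :=
      (((hasDerivAt_id u).const_mul t).neg.exp).ofReal_comp
    have h2 := h1.mul (hd u hu)
    have e : laplaceIntegrand (c + 1) f t =
        fun u : ℝ ↦ ((Real.exp (-(t * u)) : ℝ) : ℂ) * ((u : ℂ) ^ c * f u) := by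
      funext v
      rw [laplaceIntegrand, add_sub_cancel_right]
    rw [e]
    refine h2.congr_deriv ?_
    rw [laplaceIntegrand]
    push_cast
    ring
  have hI3 := (hI1.const_mul c).sub (hI2.const_mul (t : ℂ))
  -- The boundary term at infinity vanishes since the function and its derivative are integrable;
  -- the one at 0 vanishes since Re c > 0.
  have hlim := tendsto_zero_of_hasDerivAt_of_integrableOn_Ioi hder hI3 hI2
  have hcont : ContinuousWithinAt (laplaceIntegrand (c + 1) f t) (Ici 0) 0 := by
    have h1 : Continuous fun u : ℝ ↦ (u : ℂ) ^ (c + 1 - 1) :=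
      Complex.continuous_ofReal_cpow_const (by simpa using hc)
    exact ((by fun_prop : Continuous fun u : ℝ ↦
      ((Real.exp (-(t * u)) : ℝ) : ℂ)).continuousWithinAt).mul
      (h1.continuousWithinAt.mul (hfc 0 self_mem_Ici))
  have h := integral_Ioi_of_hasDerivAt_of_tendsto hcont hder hI3 hlim
  have h0 : laplaceIntegrand (c + 1) f t 0 = 0 := by
    rw [laplaceIntegrand, add_sub_cancel_right, Complex.ofReal_zero,
      Complex.zero_cpow (Complex.ne_zero_of_re_pos' hc)]
    simp
  rw [h0, sub_zero, integral_sub (hI1.const_mul c) (hI2.const_mul (t : ℂ)),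
    integral_const_mul, integral_const_mul] at h
  exact sub_eq_zero.mp h

theorem IsSlitExtension.lower_right {a b c : ℂ} (hc : 0 < c.re) {φ ψ : ℂ → ℂ}
    (hφ : IsSlitExtension a b (c + 1) φ) (hψ : IsSlitExtension (a + 1) (b + 1) (c + 2) ψ) :
    IsSlitExtension a b c (fun z ↦ φ z + z * (a * b / (c * (c + 1))) * ψ z) where
  differentiableOn := hφ.differentiableOn.add
    (((differentiableOn_id.mul_const _).mul hψ.differentiableOn))
  eq_series z hz := by
    rw [hφ.eq_series z hz, hψ.eq_series z hz, ordinaryHypergeometric_eq_add_one_right a b hc hz]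

theorem IsSlitExtension.lower_mid {a b c : ℂ} (hc : 0 < c.re) {φ ψ : ℂ → ℂ}
    (hφ : IsSlitExtension a (b + 1) c φ) (hψ : IsSlitExtension (a + 1) (b + 1) (c + 1) ψ) :
    IsSlitExtension a b c (fun z ↦ φ z - z * (a / c) * ψ z) where
  differentiableOn := hφ.differentiableOn.sub
    (((differentiableOn_id.mul_const _).mul hψ.differentiableOn))
  eq_series z hz := by
    rw [hφ.eq_series z hz, hψ.eq_series z hz, ordinaryHypergeometric_eq_add_one_mid a b hc hz]

/-- Euler's integral needs Re b < Re c; N counts how many times c must be raised by one to reach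
that range. Descending is integration by parts, based on d/du [u^c ₂F₁(a, b; c+1; -uy)] = c u^{c-1}
₂F₁(a, b; c; -uy). -/
theorem exists_isSlitExtension_laplace_aux (N : ℕ) : ∀ {a b c : ℂ}, 0 < b.re → 0 < c.re →
    b.re < c.re + N → ∃ φ : ℂ → ℂ, IsSlitExtension a b c φ ∧
      ∀ y ∈ Complex.slitPlane, HasPolynomialGrowth (fun u ↦ φ (-((u : ℂ) * y))) ∧
        ∀ t : ℝ, 0 < t → (t : ℂ) ^ c / Complex.Gamma c *
            ∫ u in Ioi (0 : ℝ), laplaceIntegrand c (fun u ↦ φ (-((u : ℂ) * y))) t u =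
          (t : ℂ) ^ b / Complex.Gamma b *
            ∫ u in Ioi (0 : ℝ), laplaceIntegrand b (fun u ↦ (1 + (u : ℂ) * y) ^ (-a)) t u := by
  induction N with
  | zero =>
    intro a b c hb hc hlt
    have hbc : 0 < (c - b).re := by simpa using hlt
    refine ⟨_, isSlitExtension_eulerIntegral a hb hbc, fun y hy ↦
      ⟨(HasPolynomialGrowth.const _).mul (hasPolynomialGrowth_eulerIntegral a hb hbc hy),
        fun t ht ↦ ?_⟩⟩
    have e : ∀ u : ℝ, laplaceIntegrand c (fun u ↦ (Complex.betaIntegral b (c - b))⁻¹ *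
        eulerIntegral a b c (-((u : ℂ) * y))) t u = (Complex.betaIntegral b (c - b))⁻¹ *
        laplaceIntegrand c (fun u ↦ eulerIntegral a b c (-((u : ℂ) * y))) t u := fun u ↦ by
      simp only [laplaceIntegrand]; ring
    simp_rw [e]
    rw [integral_const_mul, integral_laplaceIntegrand_eulerIntegral a hb hbc hy ht,
      Complex.betaIntegral_eq_Gamma_mul_div _ _ hb hbc, add_sub_cancel]
    have ht0 : (t : ℂ) ≠ 0 := by exact_mod_cast ht.ne'
    have g1 := Complex.Gamma_ne_zero_of_re_pos hb
    have g2 := Complex.Gamma_ne_zero_of_re_pos hc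
    have g3 := Complex.Gamma_ne_zero_of_re_pos hbc
    have e2 : (t : ℂ) ^ c = (t : ℂ) ^ b * (t : ℂ) ^ (c - b) := by
      rw [← Complex.cpow_add _ _ ht0, add_sub_cancel]
    have e3 : (t : ℂ) ^ (c - b) ≠ 0 := by simp [Complex.cpow_eq_zero_iff, ht0]
    rw [e2, Complex.cpow_neg]
    generalize ∫ u in Ioi (0 : ℝ),
      laplaceIntegrand b (fun u ↦ (1 + (u : ℂ) * y) ^ (-a)) t u = I
    field_simp
  | succ N ih =>
    intro a b c hb hc hlt
    push_cast at hlt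
    have hc1 : 0 < (c + 1).re := by simp; linarith
    -- Both functions in the contiguous relation for c have Re b - Re c smaller by one.
    obtain ⟨φ, hφ, hφ'⟩ := ih (a := a) (b := b) (c := c + 1) hb hc1 (by simp; linarith)
    obtain ⟨ψ, hψ, hψ'⟩ := ih (a := a + 1) (b := b + 1) (c := c + 2) (by simp; linarith)
      (by simp; linarith) (by simp; linarith)
    have hext := hφ.lower_right hc hψ
    refine ⟨_, hext, fun y hy ↦ ?_⟩
    have hgr : HasPolynomialGrowth fun u ↦ φ (-((u : ℂ) * y)) +
        -((u : ℂ) * y) * (a * b / (c * (c + 1))) * ψ (-((u : ℂ) * y)) := by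
      refine (hφ' y hy).1.add (HasPolynomialGrowth.mul ?_ (hψ' y hy).1)
      have := HasPolynomialGrowth.ofReal.mul (HasPolynomialGrowth.const
        (-y * (a * b / (c * (c + 1)))))
      convert this using 2 with u
      ring
    refine ⟨hgr, fun t ht ↦ ?_⟩
    rw [← (hφ' y hy).2 t ht]
    have hc0 := Complex.ne_zero_of_re_pos' hc
    have hc10 := Complex.ne_zero_of_re_pos' hc1
    have key := integral_laplaceIntegrand_add_one hc (hφ' y hy).1 hgr (hφ.continuousOn_comp hy)
      ((hext.continuousOn_comp hy).mono Ioi_subset_Ici_self) (fun u hu ↦ by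
        have hu0 : (u : ℂ) ≠ 0 := by exact_mod_cast hu.ne'
        have hmem := neg_mul_mem_hypergeometricDomain hy hu.le
        have h1 := (hφ.differentiableOn.differentiableAt
          (isOpen_hypergeometricDomain.mem_nhds hmem)).hasDerivAt
        rw [hφ.eqOn_deriv hc1 (by
          have : c + 1 + 1 = c + 2 := by ring
          rwa [this]) hmem] at h1
        have h2 : HasDerivAt (fun u : ℝ ↦ -((u : ℂ) * y)) (-(1 * y)) u :=
          (((hasDerivAt_id u).ofReal_comp).mul_const y).neg
        have h3 := h1.comp u h2
        refine ((hasDerivAt_ofReal_cpow_const hu.ne' hc0).mul h3).congr_deriv ?_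
        have e : (u : ℂ) ^ c = (u : ℂ) ^ (c - 1) * u := by
          nth_rewrite 3 [← Complex.cpow_one (u : ℂ)]
          rw [← Complex.cpow_add _ _ hu0, sub_add_cancel]
        simp only [Function.comp_apply]
        rw [e]
        field_simp) ht
    have ht0 : (t : ℂ) ≠ 0 := by exact_mod_cast ht.ne'
    rw [Complex.Gamma_add_one c hc0, Complex.cpow_add _ _ ht0, Complex.cpow_one]
    have g2 := Complex.Gamma_ne_zero_of_re_pos hc
    rw [div_mul_eq_mul_div, div_mul_eq_mul_div, div_eq_div_iff g2 (mul_ne_zero hc0 g2)]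
    linear_combination (t : ℂ) ^ c * Complex.Gamma c * key

/-- The extension of `₂F₁(a, b; c; ·)` to the cut plane, with its Laplace transform along rays. -/
theorem exists_isSlitExtension_laplace (a : ℂ) {b c : ℂ} (hb : 0 < b.re) (hc : 0 < c.re) :
    ∃ φ : ℂ → ℂ, IsSlitExtension a b c φ ∧
      ∀ y ∈ Complex.slitPlane, HasPolynomialGrowth (fun u ↦ φ (-((u : ℂ) * y))) ∧
        ∀ t : ℝ, 0 < t → (t : ℂ) ^ c / Complex.Gamma c *
            ∫ u in Ioi (0 : ℝ), laplaceIntegrand c (fun u ↦ φ (-((u : ℂ) * y))) t u =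
          (t : ℂ) ^ b / Complex.Gamma b *
            ∫ u in Ioi (0 : ℝ), laplaceIntegrand b (fun u ↦ (1 + (u : ℂ) * y) ^ (-a)) t u := by
  obtain ⟨N, hN⟩ := exists_nat_gt (b.re - c.re)
  exact exists_isSlitExtension_laplace_aux N hb hc (by linarith)

/-- Removes the condition Re b > 0 by raising b step by step; the parameters 1/2 + m - k and 1/2 + m
- conj k of the density may have negative real part. -/
theorem exists_isSlitExtension_aux (N : ℕ) : ∀ {a b c : ℂ}, 0 < b.re + N → 0 < c.re →
    ∃ φ : ℂ → ℂ, IsSlitExtension a b c φ := by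
  induction N with
  | zero =>
    intro a b c hb hc
    obtain ⟨φ, hφ, -⟩ := exists_isSlitExtension_laplace a (b := b) (by simpa using hb) hc
    exact ⟨φ, hφ⟩
  | succ N ih =>
    intro a b c hb hc
    push_cast at hb
    obtain ⟨φ, hφ⟩ := ih (a := a) (b := b + 1) (c := c) (by simp; linarith) hc
    obtain ⟨ψ, hψ⟩ := ih (a := a + 1) (b := b + 1) (c := c + 1) (by simp; linarith)
      (by simp; linarith)
    exact ⟨_, hφ.lower_mid hc hψ⟩

theorem exists_isSlitExtension (a b : ℂ) {c : ℂ} (hc : 0 < c.re) :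
    ∃ φ : ℂ → ℂ, IsSlitExtension a b c φ := by
  obtain ⟨N, hN⟩ := exists_nat_gt (-b.re)
  exact exists_isSlitExtension_aux N (by linarith) hc

/-- The extension to the cut plane restricts to (-∞, 1), so the default value 0 in `hypergeometricF`
does not occur. -/
theorem isHypergeometricContinuation_hypergeometricF (a b : ℂ) {c : ℂ} (hc : 0 < c.re) :
    IsHypergeometricContinuation a b c (hypergeometricF a b c) := by
  have h : ∃ F : ℝ → ℂ, IsHypergeometricContinuation a b c F := by
    obtain ⟨φ, hφ⟩ := exists_isSlitExtension a b hc
    refine ⟨fun v ↦ φ v, fun v hv ↦ ?_, fun v hv ↦ hφ.eq_series v (by simpa using hv)⟩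
    have hmem : (v : ℂ) ∈ hypergeometricDomain := by
      have : (1 : ℂ) - v = ((1 - v : ℝ) : ℂ) := by push_cast; rfl
      rw [hypergeometricDomain, mem_ofPred_eq, this, Complex.ofReal_mem_slitPlane]
      exact sub_pos.mpr hv
    exact ((hφ.differentiableOn.analyticOnNhd isOpen_hypergeometricDomain _
      hmem).restrictScalars (𝕜 := ℝ)).comp (Complex.ofRealCLM.analyticAt v)
  have e : hypergeometricF a b c = h.choose := by
    funext v
    rw [hypergeometricF, dif_pos h]
  rw [e]
  exact h.choose_spec

end SlitExtension

/-! ### Convolution of two hypergeometric functions. -/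

section Convolution

/-- The first factor is expanded in powers of s. Each moment of the second is a Bateman integral,
and B(p+n, q) turns (p)_n into (p+q)_n, which produces the series of `hasSum_appell`. -/
theorem intervalIntegral_ordinaryHypergeometric_mul (a b : ℂ) {p q : ℂ} (hp : 0 < p.re)
    (hq : 0 < q.re) {X Y : ℂ} (hX : ‖X‖ < 1 / 8) (hY : ‖Y‖ < 1 / 8) :
    ∫ s in (0 : ℝ)..1, ((s : ℂ) ^ (p - 1) * (1 - (s : ℂ)) ^ (q - 1)) *
        (ordinaryHypergeometric a (p + q - b) p (s * -X) *
          ordinaryHypergeometric b (p + q - a) q ((1 - (s : ℂ)) * -Y)) =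
      Complex.betaIntegral p q * ((1 + X) ^ (-a) * (1 + Y) ^ (-b) *
        ordinaryHypergeometric a b (p + q) (1 - ((1 + X) * (1 + Y))⁻¹)) := by
  have hX1 : ‖-X‖ < 1 := by rw [norm_neg]; linarith
  have hY1 : ‖-Y‖ < 1 := by rw [norm_neg]; linarith
  have hpq : 0 < (p + q).re := by simp; linarith
  have hball : ∀ z : ℂ, ‖z‖ < 1 → ∀ s ∈ Icc (0 : ℝ) 1, ‖(s : ℂ) * z‖ < 1 := fun z hz s hs ↦ by
    rw [norm_mul, Complex.norm_real, Real.norm_eq_abs, abs_of_nonneg hs.1]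
    exact (mul_le_of_le_one_left (norm_nonneg z) hs.2).trans_lt hz
  have hball' : ∀ s ∈ Icc (0 : ℝ) 1, ‖(1 - (s : ℂ)) * -Y‖ < 1 := fun s hs ↦ by
    have := hball (-Y) hY1 (1 - s) ⟨by linarith [hs.2], by linarith [hs.1]⟩
    simpa using this
  have hw : IntervalIntegrable (fun s : ℝ ↦ ((s : ℂ) ^ (p - 1) * (1 - (s : ℂ)) ^ (q - 1)) *
      ordinaryHypergeometric b (p + q - a) q ((1 - (s : ℂ)) * -Y)) volume 0 1 := by
    refine (Complex.betaIntegral_convergent hp hq).mul_continuousOn ?_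
    rw [uIcc_of_le zero_le_one]
    refine (differentiableOn_ordinaryHypergeometric b (p + q - a) hq).continuousOn.comp
      (f := fun s : ℝ ↦ (1 - (s : ℂ)) * -Y) (by fun_prop) fun s hs ↦ ?_
    simpa using hball' s hs
  have h := hasSum_mul_intervalIntegral_pow hw
    (summable_norm_ordinaryHypergeometric a (p + q - b) hp hX1)
    (f := fun s ↦ ordinaryHypergeometric a (p + q - b) p (s * -X)) (fun s hs ↦ by
      refine (hasSum_ordinaryHypergeometric a (p + q - b) hp
        (hball (-X) hX1 s ⟨hs.1.le, hs.2⟩)).congr_fun fun n ↦ ?_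
      rw [mul_pow]
      ring)
  have hmom : ∀ n : ℕ, ∫ s in (0 : ℝ)..1, ((s : ℂ) ^ (p - 1) * (1 - (s : ℂ)) ^ (q - 1)) *
      ordinaryHypergeometric b (p + q - a) q ((1 - (s : ℂ)) * -Y) * (s : ℂ) ^ n =
      Complex.betaIntegral (p + n) q *
        ordinaryHypergeometric b (p + q - a) (p + q + n) (-Y) := by
    intro n
    have hpn : 0 < (p + n).re := by simp; linarith [Nat.cast_nonneg (α := ℝ) n]
    have e : p + q + n = q + (p + n) := by ring
    rw [e, ← Complex.betaIntegral_symm, ← intervalIntegral_beta_mul_ordinaryHypergeometric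
      b (p + q - a) hq hpn hY1]
    -- The reflection s ↦ 1 - s brings the moment into Bateman's form, with the weights exchanged.
    have hr := intervalIntegral.integral_comp_sub_left (a := 0) (b := 1)
      (fun s : ℝ ↦ ((s : ℂ) ^ (q - 1) * (1 - (s : ℂ)) ^ (p + n - 1)) *
        ordinaryHypergeometric b (p + q - a) q (s * -Y)) 1
    rw [sub_self, sub_zero] at hr
    rw [← hr]
    refine intervalIntegral.integral_congr_ae (Eventually.of_forall fun s hs ↦ ?_)
    rw [uIoc_of_le zero_le_one] at hs
    have h0 : (s : ℂ) ≠ 0 := by exact_mod_cast hs.1.ne'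
    rw [add_sub_right_comm p (n : ℂ) 1, Complex.ofReal_sub, Complex.ofReal_one, sub_sub_cancel,
      Complex.cpow_add _ _ h0, Complex.cpow_natCast]
    ring
  have h' : HasSum (fun n ↦ ordinaryHypergeometricCoefficient a (p + q - b) p n * (-X) ^ n *
      (Complex.betaIntegral (p + n) q * ordinaryHypergeometric b (p + q - a) (p + q + n) (-Y)))
      (∫ s in (0 : ℝ)..1, ((s : ℂ) ^ (p - 1) * (1 - (s : ℂ)) ^ (q - 1)) *
        (ordinaryHypergeometric a (p + q - b) p (s * -X) *
          ordinaryHypergeometric b (p + q - a) q ((1 - (s : ℂ)) * -Y))) := by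
    convert h using 1
    · funext n
      rw [hmom]
    · refine intervalIntegral.integral_congr fun s _ ↦ ?_
      ring
  refine h'.unique (((hasSum_appell a b hpq hX hY).mul_left _).congr_fun fun n ↦ ?_)
  rw [Complex.betaIntegral_add_nat hp hq]
  have h1 := ascPochhammer_eval_ne_zero_of_re_pos hp n
  simp only [ordinaryHypergeometricCoefficient]
  field_simp

/-- The rescaled convolution of two holomorphic functions along rays is holomorphic. -/
theorem differentiableOn_rayConvolution {p q : ℂ} (hp : 0 < p.re) (hq : 0 < q.re) {φ ψ : ℂ → ℂ}
    (hφ : DifferentiableOn ℂ φ hypergeometricDomain)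
    (hψ : DifferentiableOn ℂ ψ hypergeometricDomain) (y y' : ℂ) :
    DifferentiableOn ℂ (fun z ↦ ∫ s in (0 : ℝ)..1,
      ((s : ℂ) ^ (p - 1) * (1 - (s : ℂ)) ^ (q - 1)) *
        (φ (s * -(z * y)) * ψ (((1 - s : ℝ) : ℂ) * -(z * y'))))
      {z | -(z * y) ∈ hypergeometricDomain ∧ -(z * y') ∈ hypergeometricDomain} := by
  have hU : IsOpen {z : ℂ | -(z * y) ∈ hypergeometricDomain ∧ -(z * y') ∈ hypergeometricDomain} :=
    (isOpen_hypergeometricDomain.preimage (by fun_prop)).inter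
      (isOpen_hypergeometricDomain.preimage (by fun_prop))
  have hs' : ∀ s ∈ Icc (0 : ℝ) 1, 1 - s ∈ Icc (0 : ℝ) 1 := fun s hs ↦
    ⟨by linarith [hs.2], by linarith [hs.1]⟩
  refine differentiableOn_intervalIntegral_mul (Complex.betaIntegral_convergent hp hq) hU ?_ ?_
  · refine ContinuousOn.mul ?_ ?_
    · exact hφ.continuousOn.comp (f := fun r : ℝ × ℂ ↦ (r.1 : ℂ) * -(r.2 * y)) (by fun_prop)
        fun r hr ↦ mul_mem_hypergeometricDomain hr.2.1 hr.1
    · exact hψ.continuousOn.comp (f := fun r : ℝ × ℂ ↦ ((1 - r.1 : ℝ) : ℂ) * -(r.2 * y'))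
        (by fun_prop) fun r hr ↦ mul_mem_hypergeometricDomain hr.2.2 (hs' _ hr.1)
  · intro s hs
    refine DifferentiableOn.mul ?_ ?_
    · exact hφ.comp (f := fun z : ℂ ↦ (s : ℂ) * -(z * y)) (by fun_prop)
        fun z hz ↦ mul_mem_hypergeometricDomain hz.1 hs
    · exact hψ.comp (f := fun z : ℂ ↦ ((1 - s : ℝ) : ℂ) * -(z * y')) (by fun_prop)
        fun z hz ↦ mul_mem_hypergeometricDomain hz.2 (hs' s hs)

/-- Schwarz reflection; it makes the conjugate of the Laplace kernel again a hypergeometric function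
along a ray. -/
theorem IsSlitExtension.conj_conj {a b c : ℂ} {φ : ℂ → ℂ} (hφ : IsSlitExtension a b c φ) :
    IsSlitExtension (conj a) (conj b) (conj c) (fun z ↦ conj (φ (conj z))) where
  differentiableOn z hz := by
    have hz' : conj z ∈ hypergeometricDomain := by
      have h := Complex.mem_slitPlane_iff.mp hz
      refine Complex.mem_slitPlane_iff.mpr ?_
      simpa using h
    exact (differentiableAt_conj_conj_iff.mpr (hφ.differentiableOn.differentiableAt
      (isOpen_hypergeometricDomain.mem_nhds hz'))).differentiableWithinAt
  eq_series z hz := by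
    have hz' : ‖conj z‖ < 1 := by rwa [RCLike.norm_conj]
    have hpoch : ∀ (w : ℂ) (n : ℕ), conj ((ascPochhammer ℂ n).eval w) =
        (ascPochhammer ℂ n).eval (conj w) := fun w n ↦ by
      induction n with
      | zero => simp
      | succ n ih => simp [ascPochhammer_succ_eval, ih]
    rw [hφ.eq_series _ hz', ordinaryHypergeometric_eq_tsum, ordinaryHypergeometric_eq_tsum]
    simp only [Complex.conj_tsum, smul_eq_mul, map_mul, map_inv₀, map_pow, hpoch,
      Complex.conj_conj, Complex.conj_natCast]

end Convolution

/-! ### Identification of the density with the convolution. -/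

section Density

/-- The argument of the hypergeometric function in the density. -/
noncomputable def densityArg (x : ℂ) (u : ℝ) : ℝ := u * (2 * x.re + u) / ‖x + (u : ℂ)‖ ^ 2

theorem norm_sq_add_ofReal (x : ℂ) (u : ℝ) :
    ‖x + (u : ℂ)‖ ^ 2 = ‖x‖ ^ 2 + 2 * u * x.re + u ^ 2 := by
  rw [← Complex.normSq_eq_norm_sq, ← Complex.normSq_eq_norm_sq, Complex.normSq_apply,
    Complex.normSq_apply]
  simp only [Complex.add_re, Complex.ofReal_re, Complex.add_im, Complex.ofReal_im]
  ring

theorem add_ofReal_mem_slitPlane {x : ℂ} (hx : x ∈ Complex.slitPlane) {u : ℝ} (hu : 0 ≤ u) :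
    x + (u : ℂ) ∈ Complex.slitPlane := by
  rw [Complex.mem_slitPlane_iff] at hx ⊢
  simp only [Complex.add_re, Complex.ofReal_re, Complex.add_im, Complex.ofReal_im, add_zero]
  exact hx.imp (fun h ↦ by linarith) id

theorem inv_mem_slitPlane' {x : ℂ} (hx : x ∈ Complex.slitPlane) : x⁻¹ ∈ Complex.slitPlane := by
  have h0 : 0 < Complex.normSq x := Complex.normSq_pos.mpr (Complex.slitPlane_ne_zero hx)
  rw [Complex.mem_slitPlane_iff] at hx ⊢
  rw [Complex.inv_re, Complex.inv_im]
  refine hx.imp (fun h ↦ by positivity) fun h ↦ ?_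
  exact div_ne_zero (neg_ne_zero.mpr h) h0.ne'

theorem conj_mem_slitPlane {x : ℂ} (hx : x ∈ Complex.slitPlane) : conj x ∈ Complex.slitPlane := by
  rw [Complex.mem_slitPlane_iff] at hx ⊢
  simpa using hx

theorem densityArg_lt_one {x : ℂ} (hx : x ∈ Complex.slitPlane) {u : ℝ} (hu : 0 ≤ u) :
    densityArg x u < 1 := by
  have h1 : 0 < ‖x + (u : ℂ)‖ ^ 2 := by
    have := norm_pos_iff.mpr (Complex.slitPlane_ne_zero (add_ofReal_mem_slitPlane hx hu))
    positivity
  have h2 : 0 < ‖x‖ ^ 2 := by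
    have := norm_pos_iff.mpr (Complex.slitPlane_ne_zero hx)
    positivity
  rw [densityArg, div_lt_one h1, norm_sq_add_ofReal]
  linarith

theorem ofReal_densityArg {x : ℂ} (hx : x ∈ Complex.slitPlane) {u : ℝ} (hu : 0 ≤ u) :
    (densityArg x u : ℂ) =
      1 - ((1 + (u : ℂ) * x⁻¹) * (1 + (u : ℂ) * conj x⁻¹))⁻¹ := by
  have hx0 := Complex.slitPlane_ne_zero hx
  have hx0' : conj x ≠ 0 := (map_ne_zero _).mpr hx0
  have hxu := Complex.slitPlane_ne_zero (add_ofReal_mem_slitPlane hx hu)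
  have hxu' : conj x + (u : ℂ) ≠ 0 := by
    have := (map_ne_zero (starRingEnd ℂ)).mpr hxu
    simpa using this
  have h1 : ((‖x + (u : ℂ)‖ ^ 2 : ℝ) : ℂ) = (x + u) * (conj x + u) := by
    push_cast
    rw [← Complex.mul_conj', map_add, Complex.conj_ofReal]
  have h2 : ((2 * x.re : ℝ) : ℂ) = x + conj x := by rw [Complex.add_conj]
  have e1 : 1 + (u : ℂ) * x⁻¹ = (x + u) / x := by field_simp
  have e2 : 1 + (u : ℂ) * conj x⁻¹ = (conj x + u) / conj x := by
    rw [map_inv₀]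
    field_simp
  rw [densityArg, Complex.ofReal_div, h1, Complex.ofReal_mul, Complex.ofReal_add, h2, e1, e2]
  field_simp
  ring

theorem ofReal_norm_cpow_sq {x : ℂ} (hx : x ∈ Complex.slitPlane) (a : ℂ) :
    ((‖x ^ a‖ ^ 2 : ℝ) : ℂ) = x ^ a * (conj x) ^ (conj a) := by
  rw [Complex.conj_cpow _ _ (Complex.mem_slitPlane_iff_arg.mp hx).1, Complex.conj_conj]
  push_cast
  rw [Complex.mul_conj']

/-- Near u = 0 continuity keeps arg x + arg(1 + u/x) inside (-π, π), so principal powers multiply.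
Small u suffices, as the identity theorem does the rest. -/
theorem eventually_norm_cpow_add {x : ℂ} (hx : x ∈ Complex.slitPlane) (a : ℂ) :
    ∀ᶠ u : ℝ in 𝓝[>] 0, ‖(x + (u : ℂ)) ^ a‖ = ‖x ^ a‖ * ‖(1 + (u : ℂ) * x⁻¹) ^ a‖ := by
  have hx0 := Complex.slitPlane_ne_zero hx
  have hcont : Tendsto (fun u : ℝ ↦ x.arg + (1 + (u : ℂ) * x⁻¹).arg) (𝓝[>] 0) (𝓝 x.arg) := by
    have h1 : ContinuousAt (fun u : ℝ ↦ x.arg + (1 + (u : ℂ) * x⁻¹).arg) 0 := by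
      refine continuousAt_const.add (ContinuousAt.comp (f := fun u : ℝ ↦ 1 + (u : ℂ) * x⁻¹)
        (g := Complex.arg) ?_ (by fun_prop))
      exact Complex.continuousAt_arg (by simp)
    have h2 := h1.tendsto
    simp only [Complex.ofReal_zero, zero_mul, add_zero, Complex.arg_one] at h2
    exact h2.mono_left nhdsWithin_le_nhds
  have hmem : Ioo (-Real.pi) Real.pi ∈ 𝓝 x.arg := Ioo_mem_nhds (Complex.neg_pi_lt_arg x)
    (lt_of_le_of_ne (Complex.arg_le_pi x) (Complex.mem_slitPlane_iff_arg.mp hx).1)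
  filter_upwards [hcont.eventually hmem, self_mem_nhdsWithin] with u hu hu0
  have hne : 1 + (u : ℂ) * x⁻¹ ≠ 0 := Complex.slitPlane_ne_zero
    (one_add_mul_mem_slitPlane (inv_mem_slitPlane' hx) (le_of_lt hu0))
  have e : x + (u : ℂ) = x * (1 + (u : ℂ) * x⁻¹) := by field_simp
  rw [e, Complex.norm_cpow_of_ne_zero (mul_ne_zero hx0 hne), Complex.norm_cpow_of_ne_zero hx0,
    Complex.norm_cpow_of_ne_zero hne, Complex.arg_mul hx0 hne ⟨hu.1, hu.2.le⟩, norm_mul,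
    Real.mul_rpow (norm_nonneg _) (norm_nonneg _), add_mul, Real.exp_add]
  field_simp

/-- The density is a convolution of hypergeometric functions along rays. -/
theorem betaIntegral_mul_norm_cpow_mul_hypergeometricF {x : ℂ} (hx : x ∈ Complex.slitPlane)
    {a b p q : ℂ} (hab : b = conj a) (hp : 0 < p.re) (hq : 0 < q.re) {φ ψ : ℂ → ℂ}
    (hφ : IsSlitExtension a (p + q - b) p φ) (hψ : IsSlitExtension b (p + q - a) q ψ)
    {u : ℝ} (hu : 0 < u) :
    Complex.betaIntegral p q * (((‖(x + (u : ℂ)) ^ (-a)‖ ^ 2 : ℝ) : ℂ) *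
        hypergeometricF a b (p + q) (densityArg x u)) =
      ((‖x ^ (-a)‖ ^ 2 : ℝ) : ℂ) *
        ∫ s in (0 : ℝ)..1, ((s : ℂ) ^ (p - 1) * (1 - (s : ℂ)) ^ (q - 1)) *
          (φ (s * -((u : ℂ) * x⁻¹)) * ψ (((1 - s : ℝ) : ℂ) * -((u : ℂ) * conj x⁻¹))) := by
  have hpq : 0 < (p + q).re := by simp; linarith
  have hF := isHypergeometricContinuation_hypergeometricF a b hpq
  have hy := inv_mem_slitPlane' hx
  have hy' : conj x⁻¹ ∈ Complex.slitPlane := conj_mem_slitPlane hy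
  -- The squared norm is written as a product of two powers so that analyticity in u is visible.
  set L : ℝ → ℂ := fun u ↦ Complex.betaIntegral p q * (((x + (u : ℂ)) ^ (-a) *
    (conj x + (u : ℂ)) ^ (-b)) * hypergeometricF a b (p + q) (densityArg x u)) with hL
  set R : ℂ → ℂ := fun z ↦ ∫ s in (0 : ℝ)..1, ((s : ℂ) ^ (p - 1) * (1 - (s : ℂ)) ^ (q - 1)) *
          (φ (s * -(z * x⁻¹)) * ψ (((1 - s : ℝ) : ℂ) * -(z * conj x⁻¹))) with hR
  have hnorm : ∀ u : ℝ, 0 < u → ((‖(x + (u : ℂ)) ^ (-a)‖ ^ 2 : ℝ) : ℂ) =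
      (x + (u : ℂ)) ^ (-a) * (conj x + (u : ℂ)) ^ (-b) := fun u hu ↦ by
    rw [ofReal_norm_cpow_sq (add_ofReal_mem_slitPlane hx hu.le), hab, map_neg, map_add,
      Complex.conj_ofReal]
  have hLan : AnalyticOnNhd ℝ L (Ioi 0) := by
    intro u hu
    have hu' : 0 < u := hu
    have h1 : ∀ w : ℂ, w ∈ Complex.slitPlane → ∀ e : ℂ,
        AnalyticAt ℝ (fun u : ℝ ↦ (w + (u : ℂ)) ^ e) u := fun w hw e ↦ by
      have h := ((analyticAt_const (v := w)).add (analyticAt_id (𝕜 := ℂ) (z := (u : ℂ)))).cpow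
        (analyticAt_const (v := e)) (add_ofReal_mem_slitPlane hw hu'.le)
      exact (h.restrictScalars (𝕜 := ℝ)).comp (Complex.ofRealCLM.analyticAt u)
    have h2 : AnalyticAt ℝ (densityArg x) u := by
      have e : densityArg x = fun u ↦ u * (2 * x.re + u) / (‖x‖ ^ 2 + 2 * u * x.re + u ^ 2) := by
        funext v
        rw [densityArg, norm_sq_add_ofReal]
      rw [e]
      refine AnalyticAt.div (by fun_prop) (by fun_prop) ?_
      rw [← norm_sq_add_ofReal]
      exact pow_ne_zero _ (norm_ne_zero_iff.mpr (Complex.slitPlane_ne_zero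
        (add_ofReal_mem_slitPlane hx hu'.le)))
    have h3 := (hF.analytic (densityArg x u) (densityArg_lt_one hx hu'.le)).comp h2
    exact analyticAt_const.mul (((h1 x hx (-a)).mul (h1 _ (conj_mem_slitPlane hx) (-b))).mul h3)
  have hRan : AnalyticOnNhd ℝ (fun u : ℝ ↦ ((‖x ^ (-a)‖ ^ 2 : ℝ) : ℂ) * R u) (Ioi 0) := by
    intro u hu
    have hu' : 0 < u := hu
    have hopen : IsOpen {z : ℂ | -(z * x⁻¹) ∈ hypergeometricDomain ∧
        -(z * conj x⁻¹) ∈ hypergeometricDomain} :=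
      (isOpen_hypergeometricDomain.preimage (by fun_prop)).inter
        (isOpen_hypergeometricDomain.preimage (by fun_prop))
    have h := (differentiableOn_rayConvolution hp hq hφ.differentiableOn hψ.differentiableOn
      x⁻¹ (conj x⁻¹)).analyticOnNhd hopen (u : ℂ)
      ⟨neg_mul_mem_hypergeometricDomain hy hu'.le, neg_mul_mem_hypergeometricDomain hy' hu'.le⟩
    exact analyticAt_const.mul
      ((h.restrictScalars (𝕜 := ℝ)).comp (Complex.ofRealCLM.analyticAt u))
  have hsmall : ∀ᶠ u : ℝ in 𝓝[>] 0, L u = ((‖x ^ (-a)‖ ^ 2 : ℝ) : ℂ) * R u := by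
    have hlim : ∀ᶠ u : ℝ in 𝓝[>] 0, ‖(u : ℂ) * x⁻¹‖ < 1 / 8 := by
      have h1 : Tendsto (fun u : ℝ ↦ ‖(u : ℂ) * x⁻¹‖) (𝓝 0) (𝓝 0) := by
        have : Continuous fun u : ℝ ↦ ‖(u : ℂ) * x⁻¹‖ := by fun_prop
        simpa using this.tendsto 0
      exact (h1.mono_left nhdsWithin_le_nhds).eventually (gt_mem_nhds (by norm_num))
    filter_upwards [hlim, eventually_norm_cpow_add hx (-a), self_mem_nhdsWithin] with u h1 h2 h3
    have hu' : 0 < u := h3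
    have h1' : ‖(u : ℂ) * conj x⁻¹‖ < 1 / 8 := by
      rw [norm_mul, RCLike.norm_conj, ← norm_mul]
      exact h1
    have hlt := (norm_one_sub_inv_mul_lt_one h1 (q := 1 + (u : ℂ) * conj x⁻¹)
      (by simpa using h1')).2
    have hconv := intervalIntegral_ordinaryHypergeometric_mul a b hp hq h1 h1'
    have hRu : R u = Complex.betaIntegral p q * ((1 + (u : ℂ) * x⁻¹) ^ (-a) *
        (1 + (u : ℂ) * conj x⁻¹) ^ (-b) * ordinaryHypergeometric a b (p + q)
          (1 - ((1 + (u : ℂ) * x⁻¹) * (1 + (u : ℂ) * conj x⁻¹))⁻¹)) := by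
      rw [← hconv, hR]
      refine intervalIntegral.integral_congr fun s hs ↦ ?_
      rw [uIcc_of_le zero_le_one] at hs
      have hb : ∀ r ∈ Icc (0 : ℝ) 1, ∀ z : ℂ, ‖z‖ < 1 / 8 → ‖(r : ℂ) * -z‖ < 1 :=
          fun r hr z hz ↦ by
        rw [norm_mul, norm_neg, Complex.norm_real, Real.norm_eq_abs, abs_of_nonneg hr.1]
        have := mul_le_of_le_one_left (norm_nonneg z) hr.2
        linarith
      have e : (1 - (s : ℂ)) = ((1 - s : ℝ) : ℂ) := by push_cast; rfl
      rw [hφ.eq_series _ (hb s hs _ h1), hψ.eq_series _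
        (hb (1 - s) ⟨by linarith [hs.2], by linarith [hs.1]⟩ _ h1'), e]
    have hs1 : ((‖(1 + (u : ℂ) * x⁻¹) ^ (-a)‖ ^ 2 : ℝ) : ℂ) =
        (1 + (u : ℂ) * x⁻¹) ^ (-a) * (1 + (u : ℂ) * conj x⁻¹) ^ (-b) := by
      rw [ofReal_norm_cpow_sq (one_add_mul_mem_slitPlane hy hu'.le), hab, map_neg, map_add,
        map_one, map_mul, Complex.conj_ofReal]
    rw [hRu, hL]
    simp only
    rw [← hnorm u hu', ← hs1, h2, hF.eq_series, ofReal_densityArg hx hu'.le]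
    · push_cast
      ring
    · rw [← ofReal_densityArg hx hu'.le, Complex.norm_real, Real.norm_eq_abs] at hlt
      exact hlt
  obtain ⟨ε, hε, hεs⟩ := mem_nhdsGT_iff_exists_Ioo_subset.mp hsmall
  have hε' : 0 < ε := hε
  have hmid : ε / 2 ∈ Ioo 0 ε := ⟨by linarith, by linarith⟩
  -- The identity theorem starts at the interior point ε / 2, since 0 is not in the domain (0, ∞).
  have key := hLan.eqOn_of_preconnected_of_eventuallyEq hRan isPreconnected_Ioi
    (z₀ := ε / 2) hmid.1 (by
      filter_upwards [Ioo_mem_nhds hmid.1 hmid.2] with v hv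
      exact hεs hv) hu
  rw [hnorm u hu]
  exact key

end Density

/-! ### The Whittaker function as a Laplace transform. -/

section Whittaker

/-- The substitution s = t * u, which moves t out of the power of 1 + s/z and into the exponential.
-/
theorem whittakerIntegral_eq {x : ℂ} (k μ : ℂ) {t : ℝ} (ht : 0 < t) :
    whittakerIntegral k μ (t * x) = Complex.exp (-(t * x) / 2) * (t * x) ^ k *
      ((t : ℂ) ^ (1 / 2 + μ - k) / Complex.Gamma (1 / 2 + μ - k) *
        ∫ u in Ioi (0 : ℝ), laplaceIntegrand (1 / 2 + μ - k)
          (fun u ↦ (1 + (u : ℂ) * x⁻¹) ^ (-(1 / 2 - μ - k))) t u) := by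
  have h := integral_comp_mul_left_Ioi' (fun s : ℝ ↦ Complex.exp (-(s : ℂ)) *
    (s : ℂ) ^ (μ - k - 1 / 2) * (1 + (s : ℂ) / (t * x)) ^ (μ + k - 1 / 2)) 0 ht
  have ht0 : (t : ℂ) ≠ 0 := by exact_mod_cast ht.ne'
  rw [mul_zero] at h
  rw [whittakerIntegral, ← h, Complex.real_smul, ← integral_const_mul]
  rw [div_mul_eq_mul_div, mul_div_assoc, div_mul_eq_mul_div, ← integral_const_mul]
  congr 2
  refine setIntegral_congr_fun measurableSet_Ioi fun u hu ↦ ?_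
  have hu' : 0 < u := hu
  have e1 : (t : ℂ) ^ (1 / 2 + μ - k) = t * (t : ℂ) ^ (μ - k - 1 / 2) := by
    nth_rewrite 2 [← Complex.cpow_one (t : ℂ)]
    rw [← Complex.cpow_add _ _ ht0]
    ring_nf
  have e2 : ((t * u : ℝ) : ℂ) / (t * x) = u * x⁻¹ := by
    push_cast
    rw [mul_div_mul_left _ _ ht0, div_eq_mul_inv]
  have e3 : -(1 / 2 - μ - k) = μ + k - 1 / 2 := by ring
  have e4 : (1 / 2 + μ - k) - 1 = μ - k - 1 / 2 := by ring
  simp only [laplaceIntegrand]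
  rw [e1, e2, e3, e4, Complex.ofReal_mul, Complex.mul_cpow_ofReal_nonneg ht.le hu'.le]
  push_cast
  ring

theorem IsSlitExtension.symm {a b c : ℂ} {φ : ℂ → ℂ} (h : IsSlitExtension a b c φ) :
    IsSlitExtension b a c φ where
  differentiableOn := h.differentiableOn
  eq_series z hz := by rw [h.eq_series z hz, ordinaryHypergeometric_comm]

/-- The Whittaker function as a Laplace transform symmetric under `m ↦ -m`. -/
theorem exists_whittakerW_eq {k : ℂ} (hk : k.re < 1 / 2) (m : ℂ) {x : ℂ}
    (hx : x ∈ Complex.slitPlane) :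
    ∃ φ : ℂ → ℂ, IsSlitExtension (1 / 2 + m - k) (1 / 2 - m - k) (1 / 2 - k) φ ∧
      HasPolynomialGrowth (fun u ↦ φ (-((u : ℂ) * x⁻¹))) ∧ ∀ t : ℝ, 0 < t →
        whittakerW k m (t * x) = Complex.exp (-(t * x) / 2) * (t * x) ^ k *
          ((t : ℂ) ^ (1 / 2 - k) / Complex.Gamma (1 / 2 - k) *
            ∫ u in Ioi (0 : ℝ), laplaceIntegrand (1 / 2 - k)
              (fun u ↦ φ (-((u : ℂ) * x⁻¹))) t u) := by
  have hp : 0 < (1 / 2 - k).re := by simp; norm_num at hk; linarith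
  by_cases hm : 0 < (1 / 2 + m - k).re
  · obtain ⟨φ, hφ, h⟩ := exists_isSlitExtension_laplace (1 / 2 - m - k) hm hp
    obtain ⟨h1, h2⟩ := h _ (inv_mem_slitPlane' hx)
    refine ⟨φ, hφ.symm, h1, fun t ht ↦ ?_⟩
    rw [whittakerW, if_pos hm, whittakerIntegral_eq k m ht, h2 t ht]
  · have hm' : 0 < (1 / 2 + -m - k).re := by
      simp only [Complex.sub_re, Complex.add_re, Complex.neg_re] at hm hp ⊢
      have : ((1 : ℂ) / 2).re = 1 / 2 := by norm_num
      rw [this] at hm hp ⊢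
      linarith
    obtain ⟨φ, hφ, h⟩ := exists_isSlitExtension_laplace (1 / 2 - -m - k) hm' hp
    obtain ⟨h1, h2⟩ := h _ (inv_mem_slitPlane' hx)
    refine ⟨φ, by simpa [sub_eq_add_neg] using hφ, h1, fun t ht ↦ ?_⟩
    rw [whittakerW, if_neg hm, whittakerIntegral_eq k (-m) ht, h2 t ht]

end Whittaker

/-! ### Elementary factors and assembly. -/

section Main

theorem whittakerDensity_eq {k : ℂ} (m : ℝ) (x : ℂ) {u : ℝ} (hu : 0 < u) :
    whittakerDensity k m x u = (u : ℂ) ^ ((1 - 2 * k.re : ℝ) - 1 : ℂ) *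
      (((‖(x + (u : ℂ)) ^ (-(1 / 2 + (m : ℂ) - k))‖ ^ 2 : ℝ) : ℂ) *
        hypergeometricF (1 / 2 + (m : ℂ) - k) (1 / 2 + (m : ℂ) - conj k)
          ((1 - 2 * k.re : ℝ) : ℂ) (densityArg x u)) := by
  have e1 : k - 1 / 2 - (m : ℂ) = -(1 / 2 + (m : ℂ) - k) := by ring
  have e2 : ((1 - 2 * k.re : ℝ) - 1 : ℂ) = ((-2 * k.re : ℝ) : ℂ) := by push_cast; ring
  rw [whittakerDensity, e1, e2, ← Complex.ofReal_cpow hu.le, Complex.ofReal_mul, densityArg]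
  ring

/-- The exponentials cancel and the powers of t combine to t, which cancels t⁻¹. As m is real, the
norms of x^k and x^{-(1/2+m-k)} differ only by a real power of ‖x‖. -/
theorem norm_sq_whittaker_prefactor {k : ℂ} {x : ℂ} (hx : x ≠ 0) {t : ℝ} (ht : 0 < t) (m : ℝ) :
    (t * ‖x‖)⁻¹ * Real.exp (t * x.re) * ‖Complex.exp (-(t * x) / 2) * (t * x) ^ k *
        (t : ℂ) ^ (1 / 2 - k)‖ ^ 2 =
      ‖x‖ ^ (2 * m) * ‖x ^ (-(1 / 2 + (m : ℂ) - k))‖ ^ 2 := by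
  have ht0 : (t : ℂ) ≠ 0 := by exact_mod_cast ht.ne'
  have hx0 : 0 < ‖x‖ := norm_pos_iff.mpr hx
  have e1 : ‖Complex.exp (-(t * x) / 2)‖ ^ 2 = Real.exp (-(t * x.re)) := by
    rw [Complex.norm_exp, ← Real.exp_nat_mul]
    congr 1
    have : (-((t : ℂ) * x) / 2).re = -(t * x.re) / 2 := by simp
    rw [this]
    push_cast
    ring
  have e2 : ‖((t : ℂ) * x) ^ k‖ = t ^ k.re * ‖x ^ k‖ := by
    rw [Complex.norm_cpow_of_ne_zero (mul_ne_zero ht0 hx), Complex.norm_cpow_of_ne_zero hx,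
      Complex.arg_real_mul _ ht, norm_mul, Complex.norm_real, Real.norm_eq_abs, abs_of_pos ht,
      Real.mul_rpow ht.le hx0.le, mul_div_assoc]
  have e3 : ‖(t : ℂ) ^ (1 / 2 - k)‖ = t ^ (1 / 2 - k.re) := by
    rw [Complex.norm_cpow_eq_rpow_re_of_pos ht]
    simp
  have e4 : t ^ k.re * t ^ (1 / 2 - k.re) = Real.sqrt t := by
    rw [← Real.rpow_add ht, Real.sqrt_eq_rpow]
    ring_nf
  have e5 : ‖x ^ (-(1 / 2 + (m : ℂ) - k))‖ = ‖x ^ k‖ * ‖x‖ ^ (-(1 / 2 + m)) := by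
    have h1 : -(1 / 2 + (m : ℂ) - k) = k + ((-(1 / 2 + m) : ℝ) : ℂ) := by push_cast; ring
    rw [h1, Complex.cpow_add _ _ hx, norm_mul, Complex.norm_cpow_real]
  have e6 : ‖x‖ ^ (2 * m) * (‖x‖ ^ (-(1 / 2 + m))) ^ 2 = ‖x‖⁻¹ := by
    rw [← Real.rpow_natCast, ← Real.rpow_mul hx0.le, ← Real.rpow_add hx0, ← Real.rpow_neg_one]
    congr 1
    push_cast
    ring
  rw [norm_mul, norm_mul, mul_pow, mul_pow, e1, e2, e3, e5, mul_pow (‖x ^ k‖), mul_pow _ (‖x ^ k‖)]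
  have e7 : (t ^ k.re) ^ 2 * (t ^ (1 / 2 - k.re)) ^ 2 = t := by
    rw [← mul_pow, e4, Real.sq_sqrt ht.le]
  have e8 : Real.exp (t * x.re) * Real.exp (-(t * x.re)) = 1 := by
    rw [← Real.exp_add, add_neg_cancel, Real.exp_zero]
  calc (t * ‖x‖)⁻¹ * Real.exp (t * x.re) * (Real.exp (-(t * x.re)) *
        ((t ^ k.re) ^ 2 * ‖x ^ k‖ ^ 2) * (t ^ (1 / 2 - k.re)) ^ 2)
      = (t * ‖x‖)⁻¹ * (Real.exp (t * x.re) * Real.exp (-(t * x.re))) *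
        ((t ^ k.re) ^ 2 * (t ^ (1 / 2 - k.re)) ^ 2) * ‖x ^ k‖ ^ 2 := by ring
    _ = ‖x‖⁻¹ * ‖x ^ k‖ ^ 2 := by
      rw [e7, e8]
      field_simp
    _ = ‖x‖ ^ (2 * m) * (‖x‖ ^ (-(1 / 2 + m))) ^ 2 * ‖x ^ k‖ ^ 2 := by rw [e6]
    _ = _ := by ring

theorem conj_laplaceIntegrand (p : ℂ) (g : ℝ → ℂ) (t : ℝ) {u : ℝ} (hu : 0 < u) :
    conj (laplaceIntegrand p g t u) = laplaceIntegrand (conj p) (fun u ↦ conj (g u)) t u := by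
  have h : (u : ℂ).arg ≠ Real.pi := by
    rw [Complex.arg_ofReal_of_nonneg hu.le]
    exact Real.pi_pos.ne
  have e : conj p - 1 = conj (p - 1) := by simp
  rw [laplaceIntegrand, laplaceIntegrand, map_mul, map_mul, Complex.conj_ofReal, e,
    Complex.cpow_conj _ _ h, Complex.conj_ofReal]

end Main

theorem corollary2p2 (x : ℂ) (hx : x ≠ 0) (harg : |x.arg| < Real.pi)
    (t : ℝ) (ht : 0 < t) (m : ℝ) (k : ℂ) (hk : k.re < 1 / 2) :
    MeasureTheory.IntegrableOn
      (fun u : ℝ => ((Real.exp (-(t * u)) : ℝ) : ℂ) * whittakerDensity k m x u) (Set.Ioi 0) ∧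
    (((t * ‖x‖)⁻¹ * Real.exp (t * x.re) * ‖whittakerW k (m : ℂ) ((t : ℂ) * x)‖ ^ 2 : ℝ) : ℂ) =
      ((‖x‖ ^ (2 * m) / Real.Gamma (1 - 2 * k.re) : ℝ) : ℂ) *
        ∫ u in Set.Ioi (0 : ℝ),
          ((Real.exp (-(t * u)) : ℝ) : ℂ) * whittakerDensity k m x u := by
  have hxs : x ∈ Complex.slitPlane := Complex.mem_slitPlane_iff_arg.mpr
    ⟨fun h ↦ by rw [h, abs_of_pos Real.pi_pos] at harg; exact lt_irrefl _ harg, hx⟩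
  have hy := inv_mem_slitPlane' hxs
  obtain ⟨φ, hφ, hgr, hW⟩ := exists_whittakerW_eq hk (m : ℂ) hxs
  set a : ℂ := 1 / 2 + (m : ℂ) - k with ha
  set b : ℂ := 1 / 2 + (m : ℂ) - conj k with hb
  set p : ℂ := 1 / 2 - k with hp
  set q : ℂ := conj p with hq
  set c : ℝ := 1 - 2 * k.re with hc
  have hpr : 0 < p.re := by rw [hp]; simp; norm_num at hk; linarith
  have hqr : 0 < q.re := by rw [hq, Complex.conj_re]; exact hpr
  have hc0 : 0 < c := by rw [hc]; linarith
  have hhalf : conj (1 / 2 : ℂ) = 1 / 2 := by rw [map_div₀, map_one, Complex.conj_ofNat]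
  have hab : b = conj a := by rw [ha, hb, map_sub, map_add, hhalf, Complex.conj_ofReal]
  have hkk : k + conj k = ((2 * k.re : ℝ) : ℂ) := Complex.add_conj k
  have hpq : p + q = (c : ℂ) := by
    rw [hq, hp, hc, Complex.ofReal_sub, ← hkk, map_sub, hhalf, Complex.ofReal_one]
    ring
  have hd : 1 / 2 - (m : ℂ) - k = p + q - b := by
    rw [hpq, hb, hc, Complex.ofReal_sub, ← hkk, Complex.ofReal_one]
    ring
  have hd' : conj (1 / 2 - (m : ℂ) - k) = p + q - a := by
    rw [hd, map_sub, map_add, hq, Complex.conj_conj, hab, Complex.conj_conj, add_comm]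
  rw [hd] at hφ hd'
  set ψ : ℂ → ℂ := fun z ↦ conj (φ (conj z)) with hψdef
  have hψ : IsSlitExtension b (p + q - a) q ψ := by
    have := hφ.conj_conj
    rwa [hd', ← hab] at this
  have hψray : (fun u : ℝ ↦ ψ (-((u : ℂ) * conj x⁻¹))) =
      fun u : ℝ ↦ conj (φ (-((u : ℂ) * x⁻¹))) := by
    funext u
    simp [hψdef]
  have hIφ := integrableOn_laplaceIntegrand hpr hgr
    ((hφ.continuousOn_comp hy).mono Ioi_subset_Ici_self) ht
  have hIψ : IntegrableOn (laplaceIntegrand q (fun u : ℝ ↦ ψ (-((u : ℂ) * conj x⁻¹))) t)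
      (Ioi 0) := by
    refine integrableOn_laplaceIntegrand hqr ?_
      ((hψ.continuousOn_comp (conj_mem_slitPlane hy)).mono Ioi_subset_Ici_self) ht
    rw [hψray]
    exact hgr.conj
  obtain ⟨hconvI, hconv⟩ := integral_laplaceIntegrand_convolution hIφ hIψ
  set I : ℂ := ∫ u in Ioi (0 : ℝ), laplaceIntegrand p (fun u ↦ φ (-((u : ℂ) * x⁻¹))) t u with hI
  have hconj : ∫ u in Ioi (0 : ℝ), laplaceIntegrand q (fun u : ℝ ↦ ψ (-((u : ℂ) * conj x⁻¹))) t u =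
      conj I := by
    rw [hI, ← integral_conj, hψray]
    refine setIntegral_congr_fun measurableSet_Ioi fun u hu ↦ ?_
    exact (conj_laplaceIntegrand p _ t hu).symm
  rw [hconj] at hconv
  have hB0 : Complex.betaIntegral p q ≠ 0 := by
    rw [Complex.betaIntegral_eq_Gamma_mul_div _ _ hpr hqr]
    refine div_ne_zero (mul_ne_zero (Complex.Gamma_ne_zero_of_re_pos hpr)
      (Complex.Gamma_ne_zero_of_re_pos hqr)) (Complex.Gamma_ne_zero_of_re_pos ?_)
    rw [hpq]
    exact hc0
  -- The ratio of the density to the convolution kernel; B(p, q) = |Γ(p)|² / Γ(1 - 2 Re k) later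
  -- supplies the Gamma factor.
  set A : ℂ := ((‖x ^ (-a)‖ ^ 2 : ℝ) : ℂ) / Complex.betaIntegral p q with hA
  have hdens : EqOn (fun u : ℝ ↦ A * laplaceIntegrand (p + q) (fun u : ℝ ↦ ∫ s in (0 : ℝ)..1,
        ((s : ℂ) ^ (p - 1) * (1 - (s : ℂ)) ^ (q - 1)) *
          (φ (-(((s * u : ℝ) : ℂ) * x⁻¹)) * ψ (-((((1 - s) * u : ℝ) : ℂ) * conj x⁻¹)))) t u)
      (fun u : ℝ ↦ ((Real.exp (-(t * u)) : ℝ) : ℂ) * whittakerDensity k m x u) (Ioi 0) := by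
    intro u hu
    have hmain := betaIntegral_mul_norm_cpow_mul_hypergeometricF hxs hab hpr hqr hφ hψ hu
    have hint : ∀ s : ℝ, φ (-(((s * u : ℝ) : ℂ) * x⁻¹)) *
        ψ (-((((1 - s) * u : ℝ) : ℂ) * conj x⁻¹)) =
        φ (s * -((u : ℂ) * x⁻¹)) * ψ (((1 - s : ℝ) : ℂ) * -((u : ℂ) * conj x⁻¹)) := fun s ↦ by
      rw [Complex.ofReal_mul s u, Complex.ofReal_mul (1 - s) u, mul_neg, mul_neg, mul_assoc,
        mul_assoc]
    simp only [laplaceIntegrand, hint]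
    rw [whittakerDensity_eq m x hu, ← ha, ← hb, ← hc, ← hpq, hA]
    rw [div_mul_eq_mul_div, div_eq_iff hB0]
    linear_combination (-((Real.exp (-(t * u)) : ℝ) : ℂ) * (u : ℂ) ^ (p + q - 1)) * hmain
  refine ⟨IntegrableOn.congr_fun (hconvI.const_mul A) hdens measurableSet_Ioi, ?_⟩
  rw [← setIntegral_congr_fun measurableSet_Ioi hdens, integral_const_mul, hconv, hW t ht,
    Complex.mul_conj']
  have hΓq : Complex.Gamma q = conj (Complex.Gamma p) := Complex.Gamma_conj p
  have hΓ : Complex.betaIntegral p q = ((‖Complex.Gamma p‖ ^ 2 / Real.Gamma c : ℝ) : ℂ) := by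
    rw [Complex.betaIntegral_eq_Gamma_mul_div _ _ hpr hqr, hΓq, Complex.mul_conj', hpq,
      Complex.Gamma_ofReal]
    push_cast
    rfl
  have hΓ0 : ‖Complex.Gamma p‖ ≠ 0 := norm_ne_zero_iff.mpr (Complex.Gamma_ne_zero_of_re_pos hpr)
  have hΓc : Real.Gamma c ≠ 0 := (Real.Gamma_pos_of_pos hc0).ne'
  have hpre := norm_sq_whittaker_prefactor (k := k) hx ht m
  rw [← ha, ← hp] at hpre
  have hsplit : ‖Complex.exp (-(t * x) / 2) * (t * x) ^ k *
      ((t : ℂ) ^ p / Complex.Gamma p * I)‖ ^ 2 =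
      ‖Complex.exp (-(t * x) / 2) * (t * x) ^ k * (t : ℂ) ^ p‖ ^ 2 *
        (‖I‖ ^ 2 / ‖Complex.Gamma p‖ ^ 2) := by
    simp only [norm_mul, norm_div]
    field_simp
  rw [hsplit, ← mul_assoc, hpre, hA, hΓ]
  norm_cast
  field_simp
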